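/- There are absolute constants $K>0$ and $p\in\mathbb N$ such that the following holds. Let $n\ge 2$, $\sigma\ge 0$, $\delta\in(0,1]$, let $\theta_{1:n}=(\theta_1,\dots,\theta_n)\in\mathbb R^n$ belong to $\mathrm{TV}(C_n)$, that is, $\|D\theta_{1:n}\|_1=\sum_{t=2}^n|\theta_t-\theta_{t-1}|\le C_n$, and let $|\theta_1|\le U$. Let $y_t=\theta_t+Z_t$, $t=1,\dots,n$, where $Z_1,\dots,Z_n$ are independent random variables that are $\sigma$-subgaussian: $\mathbb E\,e^{sZ_t}\le e^{s^2\sigma^2/2}$ for all $s\in\mathbb R$ (so they have mean zero). Let $x_1,\dots,x_n$ be the predictions of the policy ARROWS described below, run on the observations $y_t$ with inputs $n,\sigma$ and $\beta=24+\frac{8\log(8/\delta)}{\log n}$. Then with probability at least $1-\delta$ the dynamic regret for the losses $\ell_t(x)=(x-\theta_t)^2$ satisfies $$\sum_{t=1}^n\ell_t(x_t)-\sum_{t=1}^n\inf_{x\in\mathbb R}\ell_t(x)=\sum_{t=1}^n(x_t-\theta_t)^2\le K\bigl(1+\log n+\log(1/\delta)\bigr)^p\Bigl(n^{1/3}C_n^{2/3}\sigma^{4/3}+U^2+C_n^2+\sigma^2\Bigr),$$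 i.e. it is $\tilde O(n^{1/3}C_n^{2/3}\sigma^{4/3}+U^2+C_n^2+\sigma^2)$, where $\tilde O$ hides factors that are polylogarithmic in $n$ and $1/\delta$. The policy ARROWS: put $y_0=0$ and start the first bin at $t_h=1$. In round $t=1,\dots,n$, with $t_h$ the start time of the current bin, predict $x_t=y_{t-1}$ if $t=t_h$ (a new bin), and otherwise the average $x_t=\bar y_{t_h:t-1}$ of $y_{t_h},\dots,y_{t-1}$. Then observe $y_t$, let $\tilde y$ be the vector $(y_{t_h}-\bar y_{t_h:t},\dots,y_t-\bar y_{t_h:t})$ padded by zeros at its end to length $k$, the least power of $2$ that is at least $t-t_h+1$, and let $\hat\alpha=T(H\tilde y)$, where $H$ is the $k\times k$ orthogonal discrete Haar wavelet transform and $T$ is coordinatewise soft thresholding with threshold $\sigma\sqrt{\beta\log n}$. Write $\hat\alpha[l]$, $0\le l<\log_2 k$, for the block of the $2^l$ Haar coefficients at level $l$ ($l=0$ the coarsest). If $\frac1{\sqrt k}\sum_{l=0}^{\log_2 k-1}2^{l/2}\|\hat\alpha[l]\|_1>\frac{\sigma}{\sqrt k}$, then a new bin starts at $t_h=t+1$;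 otherwise the current bin continues. -/

import Mathlib

/-! Sequences `θ 1, …, θ n` and `y 1, …, y n` are functions on `ℕ` of which only the values at
`1, …, n` are used. -/

namespace Arrows

/-- The total variation class `TV(C)`: the sequences `θ 1, …, θ n` with
`‖Dθ‖₁ = |θ 2 - θ 1| + … + |θ n - θ (n-1)| ≤ C`. -/
def TVClass (n : ℕ) (C : ℝ) : Set (ℕ → ℝ) :=
  {θ | ∑ t ∈ Finset.Ico 1 n, |θ (t + 1) - θ t| ≤ C}

/-- The quadratic loss `ℓ_t(x) = (x - θ t)²`. -/
def quadLoss (θ : ℕ → ℝ) (t : ℕ) (x : ℝ) : ℝ := (x - θ t) ^ 2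

/-- The (realized) dynamic regret `∑ₜ ℓ_t(x t) - ∑ₜ inf_z ℓ_t(z)` of the predictions
`x 1, …, x n`. -/
noncomputable def dynamicRegret (n : ℕ) (loss : ℕ → ℝ → ℝ) (x : ℕ → ℝ) : ℝ :=
  ∑ t ∈ Finset.Icc 1 n, loss t (x t) - ∑ t ∈ Finset.Icc 1 n, ⨅ z : ℝ, loss t z

/-- The average of `y a, …, y b`. -/
noncomputable def avg (y : ℕ → ℝ) (a b : ℕ) : ℝ :=
  (∑ s ∈ Finset.Icc a b, y s) / ((b + 1 - a : ℕ) : ℝ)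

/-- The exponent `J` of the padded length: `2 ^ J` is the least power of `2` that is at least the
number `b + 1 - a` of the indices `a, …, b`. -/
def padExp (a b : ℕ) : ℕ := Nat.clog 2 (b + 1 - a)

/-- `y a, …, y b`, recentred by its average, then padded by zeros at the end. -/
noncomputable def pad0 (y : ℕ → ℝ) (a b : ℕ) : Fin (2 ^ padExp a b) → ℝ :=
  fun j => if a + (j : ℕ) ≤ b then y (a + (j : ℕ)) - avg y a b else 0

/-- The orthogonal discrete Haar transform matrix of size `2 ^ J`. Row `0` is constant. Row
`2 ^ l + i` with `l < J` and `i < 2 ^ l` is the wavelet of level `l` at position `i`: it is supported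
on the `i`-th block of length `2 ^ (J - l)`, with values `(2 ^ (J - l)) ^ (-1/2)` on the first half of
this block and the opposite value on the second half. -/
noncomputable def haarMatrix (J : ℕ) : Matrix (Fin (2 ^ J)) (Fin (2 ^ J)) ℝ :=
  fun r c =>
    if (r : ℕ) = 0 then 1 / Real.sqrt (2 ^ J)
    else
      let l := Nat.log 2 (r : ℕ)
      let i := (r : ℕ) - 2 ^ l
      let B := 2 ^ (J - l)
      if (c : ℕ) / B = i then
        (if (c : ℕ) % B < B / 2 then 1 / Real.sqrt (B : ℝ) else -(1 / Real.sqrt (B : ℝ)))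
      else 0

/-- Soft thresholding with threshold `lam`. -/
noncomputable def softThreshold (lam x : ℝ) : ℝ := Real.sign x * max (|x| - lam) 0

/-- The denoised Haar coefficients `T(H pad₀(y a, …, y b))`, where `T` is coordinatewise soft
thresholding with threshold `σ √(β log n)`. -/
noncomputable def coeffs (n : ℕ) (σ β : ℝ) (y : ℕ → ℝ) (a b : ℕ) : Fin (2 ^ padExp a b) → ℝ :=
  fun r => softThreshold (σ * Real.sqrt (β * Real.log n))
    ((haarMatrix (padExp a b)).mulVec (pad0 y a b) r)

/-- The `ℓ¹` norm of the block of level `l`, which holds the coordinates `2 ^ l, …, 2 ^ (l+1) - 1`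
when coordinates are numbered from `0`. -/
noncomputable def levelNorm {J : ℕ} (α : Fin (2 ^ J) → ℝ) (l : ℕ) : ℝ :=
  ∑ r ∈ Finset.univ.filter
      (fun r : Fin (2 ^ J) => 2 ^ l ≤ (r : ℕ) ∧ (r : ℕ) < 2 ^ (l + 1)), |α r|

/-- The restart rule, evaluated at time `t` in a bin that started at time `h`. -/
def Restart (n : ℕ) (σ β : ℝ) (y : ℕ → ℝ) (h t : ℕ) : Prop :=
  σ / Real.sqrt (2 ^ padExp h t) <
    1 / Real.sqrt (2 ^ padExp h t) *
      ∑ l ∈ Finset.range (padExp h t), Real.sqrt (2 ^ l) * levelNorm (coeffs n σ β y h t) l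

open Classical in
/-- The start time `t_h` of the current bin at the beginning of round `t` (the value at `t = 0` is
not used). -/
noncomputable def binStart (n : ℕ) (σ β : ℝ) (y : ℕ → ℝ) : ℕ → ℕ
  | 0 => 1
  | 1 => 1
  | t + 2 =>
    if Restart n σ β y (binStart n σ β y (t + 1)) (t + 1) then t + 2
    else binStart n σ β y (t + 1)

/-- The prediction of ARROWS in round `t ≥ 1`. The bin is new exactly if it starts at `t`; then the
previous observation is predicted, with the convention `y₀ = 0`. Otherwise the prediction is the
average of the observations in the current bin. -/
noncomputable def predict (n : ℕ) (σ β : ℝ) (y : ℕ → ℝ) (t : ℕ) : ℝ :=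
  if binStart n σ β y t = t then (if t = 1 then 0 else y (t - 1))
  else avg y (binStart n σ β y t) (t - 1)

end Arrows

/-!
Outside an event of probability at most `δ`, a union bound over all segments of `1, …, n` shows
that every Haar coefficient of the noise on a segment lies below the threshold, and every
normalized average of the noise as well. On the good event soft thresholding only shrinks: each
denoised coefficient is at most the corresponding coefficient of `θ` in absolute value, and the
latter exceeds the former by at most twice the threshold.

As long as a bin continues, the restart statistic is at most `σ`. So the squared deviation of `θ`
from its average on the bin is at most `O(σ²)` plus a contribution of the small coefficients, of
order `λ^{4/3} ∑ |coefficient|^{2/3}` for the threshold `λ`. By Hölder's inequality and the bound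
of the `ℓ¹` norm of each Haar level by the variation `V` of `θ`, this is `σ^{4/3} L^{1/3} V^{2/3}`
for a bin of length `L`, up to logarithms; a telescoping estimate transfers it from the average on
the bin to the running averages that are predicted. Conversely, a restart forces `σ` to be at most
the restart statistic of `θ` itself, hence `σ² ≲ σ^{4/3} L^{1/3} V^{2/3}`: every bin but the last
pays for its own noise. Hölder's inequality over the bins, whose lengths add up to `n` and whose
variations add up to at most `C`, gives the bound.
-/

namespace Arrows

open Finset

/-! ### Haar coefficients -/

/-- The sum of `f` over the `i`-th block of length `b`, counted from `0`. -/
def blockSum (f : ℕ → ℝ) (b i : ℕ) : ℝ := ∑ j ∈ Ico (i * b) ((i + 1) * b), f j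

/-- The coefficient of `f` with respect to the Haar wavelet on the `i`-th block of length
`2 * b`. -/
noncomputable def haarCoef (b : ℕ) (f : ℕ → ℝ) (i : ℕ) : ℝ :=
  (blockSum f b (2 * i) - blockSum f b (2 * i + 1)) / √(2 * b)

/-- The Haar wavelet on the `i`-th block of length `2 * b`, in the form that the rows of
`haarMatrix` have. -/
noncomputable def haarWave (b i c : ℕ) : ℝ :=
  if c / (2 * b) = i then
    (if c % (2 * b) < b then 1 / √(2 * b) else -(1 / √(2 * b)))
  else 0

/-- The total variation of `f` on the integers `a, …, b`. -/
def variation (f : ℕ → ℝ) (a b : ℕ) : ℝ := ∑ u ∈ Ico a b, |f (u + 1) - f u|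

theorem blockSum_two_mul (f : ℕ → ℝ) (b i : ℕ) :
    blockSum f (2 * b) i = blockSum f b (2 * i) + blockSum f b (2 * i + 1) := by
  have left_end : i * (2 * b) = 2 * i * b := by ring
  have right_end : (i + 1) * (2 * b) = (2 * i + 1 + 1) * b := by ring
  rw [blockSum, left_end, right_end]
  exact (sum_Ico_consecutive f (by gcongr; omega) (by gcongr; omega)).symm

theorem sum_blockSum (f : ℕ → ℝ) (b N : ℕ) :
    ∑ i ∈ range N, blockSum f b i = ∑ j ∈ range (N * b), f j := by
  induction N with
  | zero => simp
  | succ N ih =>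
    rw [sum_range_succ, ih, blockSum, range_eq_Ico, range_eq_Ico]
    exact sum_Ico_consecutive f (Nat.zero_le _) (by gcongr; omega)

theorem haarWave_of_left_half {b i c : ℕ} (hc : c ∈ Ico (2 * i * b) ((2 * i + 1) * b)) :
    haarWave b i c = 1 / √(2 * b) := by
  obtain ⟨j, rfl⟩ := Nat.exists_eq_add_of_le (mem_Ico.1 hc).1
  have hj : j < b := by have := (mem_Ico.1 hc).2; linarith
  have split : 2 * i * b + j = j + 2 * b * i := by ring
  have quot : (2 * i * b + j) / (2 * b) = i := by
    rw [split, Nat.add_mul_div_left _ _ (by omega), Nat.div_eq_of_lt (by omega), zero_add]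
  have rem : (2 * i * b + j) % (2 * b) = j := by
    rw [split, Nat.add_mul_mod_self_left, Nat.mod_eq_of_lt (by omega)]
  simp only [haarWave, quot, rem, if_true, if_pos hj]

theorem haarWave_of_right_half {b i c : ℕ}
    (hc : c ∈ Ico ((2 * i + 1) * b) ((2 * i + 1 + 1) * b)) :
    haarWave b i c = -(1 / √(2 * b)) := by
  obtain ⟨j, rfl⟩ := Nat.exists_eq_add_of_le (mem_Ico.1 hc).1
  have hj : j < b := by have := (mem_Ico.1 hc).2; linarith
  have split : (2 * i + 1) * b + j = b + j + 2 * b * i := by ring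
  have quot : ((2 * i + 1) * b + j) / (2 * b) = i := by
    rw [split, Nat.add_mul_div_left _ _ (by omega), Nat.div_eq_of_lt (by omega), zero_add]
  have rem : ((2 * i + 1) * b + j) % (2 * b) = b + j := by
    rw [split, Nat.add_mul_mod_self_left, Nat.mod_eq_of_lt (by omega)]
  simp only [haarWave, quot, rem, if_true, if_neg (show ¬ b + j < b by omega)]

theorem haarWave_of_mem_block_of_ne {b i q c : ℕ} (hq : q ≠ i)
    (hc : c ∈ Ico (q * (2 * b)) ((q + 1) * (2 * b))) : haarWave b i c = 0 := by
  have quot : c / (2 * b) = q := Nat.div_eq_of_lt_le (mem_Ico.1 hc).1 (mem_Ico.1 hc).2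
  simp only [haarWave, quot, if_neg hq]

theorem sum_haarWave_mul {b i N : ℕ} (hi : i < N) (f : ℕ → ℝ) :
    ∑ c ∈ range (N * (2 * b)), haarWave b i c * f c = haarCoef b f i := by
  have left_half : blockSum (fun c => haarWave b i c * f c) b (2 * i) =
      1 / √(2 * b) * blockSum f b (2 * i) := by
    simp only [blockSum, mul_sum]
    exact sum_congr rfl fun c hc => by rw [haarWave_of_left_half hc]
  have right_half : blockSum (fun c => haarWave b i c * f c) b (2 * i + 1) =
      -(1 / √(2 * b)) * blockSum f b (2 * i + 1) := by
    simp only [blockSum, mul_sum]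
    exact sum_congr rfl fun c hc => by rw [haarWave_of_right_half hc]
  rw [← sum_blockSum, sum_eq_single_of_mem i (mem_range.2 hi), blockSum_two_mul, left_half,
    right_half, haarCoef]
  · ring
  · intro q _ hq
    exact sum_eq_zero fun c hc => by rw [haarWave_of_mem_block_of_ne hq hc, zero_mul]

theorem haarMatrix_eq_haarWave {J l i : ℕ} (hl : l < J) (hi : i < 2 ^ l)
    {r : Fin (2 ^ J)} (hr : (r : ℕ) = 2 ^ l + i) (c : Fin (2 ^ J)) :
    haarMatrix J r c = haarWave (2 ^ (J - l - 1)) i c := by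
  have row_ne_zero : (r : ℕ) ≠ 0 := by have := Nat.two_pow_pos l; omega
  have log_row : Nat.log 2 (r : ℕ) = l := by
    rw [Nat.log_eq_iff (by right; exact ⟨by norm_num, row_ne_zero⟩), pow_succ]; omega
  have block : 2 ^ (J - l) = 2 * 2 ^ (J - l - 1) := by
    rw [← pow_succ']; congr 1; omega
  have half_block : 2 * 2 ^ (J - l - 1) / 2 = 2 ^ (J - l - 1) := by omega
  have position : (r : ℕ) - 2 ^ l = i := by omega
  simp only [haarMatrix, row_ne_zero, if_false, log_row, block, half_block, position, haarWave,
    Nat.cast_mul, Nat.cast_ofNat]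

theorem haarMatrix_mulVec {J l i : ℕ} (hl : l < J) (hi : i < 2 ^ l)
    {r : Fin (2 ^ J)} (hr : (r : ℕ) = 2 ^ l + i) (f : ℕ → ℝ) :
    (haarMatrix J).mulVec (fun c => f c) r = haarCoef (2 ^ (J - l - 1)) f i := by
  have length : 2 ^ J = 2 ^ l * (2 * 2 ^ (J - l - 1)) := by
    rw [← pow_succ', ← pow_add]; congr 1; omega
  rw [← sum_haarWave_mul hi, ← length, Finset.sum_range]
  simp only [Matrix.mulVec, dotProduct, haarMatrix_eq_haarWave hl hi hr]

theorem levelNorm_eq_sum_range {J l : ℕ} (hl : l < J) {α : Fin (2 ^ J) → ℝ} {g : ℕ → ℝ}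
    (hg : ∀ i < 2 ^ l, ∀ r : Fin (2 ^ J), (r : ℕ) = 2 ^ l + i → α r = g i) :
    levelNorm α l = ∑ i ∈ range (2 ^ l), |g i| := by
  have level_le : 2 ^ (l + 1) ≤ 2 ^ J := Nat.pow_le_pow_right (by norm_num) hl
  rw [pow_succ] at level_le
  simp only [levelNorm, pow_succ]
  refine sum_bij' (fun r _ => (r : ℕ) - 2 ^ l)
    (fun i hi => ⟨2 ^ l + i, by have := mem_range.1 hi; omega⟩) ?_ ?_ ?_ ?_ ?_
  · intro r hr
    rw [mem_filter] at hr
    rw [mem_range]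
    omega
  · intro i hi
    simp only [mem_filter, mem_univ, true_and]
    have := mem_range.1 hi
    omega
  · intro r hr
    ext
    exact Nat.add_sub_cancel' (mem_filter.1 hr).2.1
  · intro i _
    exact Nat.add_sub_cancel_left ..
  · intro r hr
    rw [mem_filter] at hr
    rw [hg ((r : ℕ) - 2 ^ l) (by omega) r (by omega)]

theorem sum_haarCoef_sq (b : ℕ) (f : ℕ → ℝ) (N : ℕ) :
    ∑ i ∈ range N, haarCoef b f i ^ 2 =
      ∑ i ∈ range (N * 2), blockSum f b i ^ 2 / b
        - ∑ i ∈ range N, blockSum f (2 * b) i ^ 2 / (2 * b) := by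
  rw [← sum_blockSum (fun i => blockSum f b i ^ 2 / b), ← sum_sub_distrib]
  refine sum_congr rfl fun i _ => ?_
  have pair : Ico (i * 2) ((i + 1) * 2) = {2 * i, 2 * i + 1} := by
    ext j; simp only [mem_Ico, mem_insert, mem_singleton]; omega
  rw [blockSum_two_mul, haarCoef, div_pow, Real.sq_sqrt (by positivity), blockSum.eq_1 _ 2, pair,
    sum_pair (by omega)]
  ring

theorem sum_sq_eq_sum_haarCoef_sq (J : ℕ) (f : ℕ → ℝ) :
    ∑ j ∈ range (2 ^ J), f j ^ 2 = (∑ j ∈ range (2 ^ J), f j) ^ 2 / 2 ^ J +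
      ∑ l ∈ range J, ∑ i ∈ range (2 ^ l), haarCoef (2 ^ (J - l - 1)) f i ^ 2 := by
  set energy : ℕ → ℝ := fun l =>
    ∑ i ∈ range (2 ^ l), blockSum f (2 ^ (J - l)) i ^ 2 / (2 ^ (J - l) : ℕ) with energy_def
  have level_energy : ∀ l ∈ range J,
      ∑ i ∈ range (2 ^ l), haarCoef (2 ^ (J - l - 1)) f i ^ 2 = energy (l + 1) - energy l := by
    intro l hl
    have hl := mem_range.1 hl
    have block : 2 * 2 ^ (J - l - 1) = 2 ^ (J - l) := by rw [← pow_succ']; congr 1; omega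
    have block_cast : (2 : ℝ) * (2 ^ (J - l - 1) : ℕ) = (2 ^ (J - l) : ℕ) := by
      rw [← block]; push_cast; ring
    rw [sum_haarCoef_sq, block, block_cast, ← pow_succ, energy_def, Nat.sub_sub]
  rw [sum_congr rfl level_energy, sum_range_sub]
  simp [energy_def, blockSum]

theorem variation_nonneg (f : ℕ → ℝ) (a b : ℕ) : 0 ≤ variation f a b :=
  sum_nonneg fun _ _ => abs_nonneg _

theorem variation_mono (f : ℕ → ℝ) {a b s t : ℕ} (has : a ≤ s) (htb : t ≤ b) :
    variation f s t ≤ variation f a b :=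
  sum_le_sum_of_subset_of_nonneg (Ico_subset_Ico has htb) fun _ _ _ => abs_nonneg _

theorem abs_sub_le_variation (f : ℕ → ℝ) {a b s t : ℕ} (hs : s ∈ Icc a b) (ht : t ∈ Icc a b) :
    |f s - f t| ≤ variation f a b := by
  wlog hst : s ≤ t generalizing s t
  · rw [abs_sub_comm]
    exact this ht hs (Nat.le_of_not_le hst)
  calc |f s - f t| = |∑ u ∈ Ico s t, (f (u + 1) - f u)| := by
        rw [sum_Ico_sub f hst, abs_sub_comm]
    _ ≤ variation f s t := abs_sum_le_sum_abs _ _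
    _ ≤ variation f a b := variation_mono f (mem_Icc.1 hs).1 (mem_Icc.1 ht).2

theorem abs_haarCoef_le (b : ℕ) (f : ℕ → ℝ) (i : ℕ) :
    |haarCoef b f i| ≤ √(2 * b) / 2 * variation f (i * (2 * b)) ((i + 1) * (2 * b)) := by
  set V := variation f (i * (2 * b)) ((i + 1) * (2 * b))
  have shifted : blockSum f b (2 * i + 1) =
      ∑ j ∈ Ico (2 * i * b) ((2 * i + 1) * b), f (j + b) := by
    rw [sum_Ico_add' f, blockSum]
    congr 2 <;> ring
  have halves : |blockSum f b (2 * i) - blockSum f b (2 * i + 1)| ≤ b * V :=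
    calc |blockSum f b (2 * i) - blockSum f b (2 * i + 1)|
        = |∑ j ∈ Ico (2 * i * b) ((2 * i + 1) * b), (f j - f (j + b))| := by
          rw [shifted, blockSum, sum_sub_distrib]
      _ ≤ ∑ j ∈ Ico (2 * i * b) ((2 * i + 1) * b), |f j - f (j + b)| :=
          abs_sum_le_sum_abs _ _
      _ ≤ ∑ _j ∈ Ico (2 * i * b) ((2 * i + 1) * b), V := by
          refine sum_le_sum fun j hj => ?_
          obtain ⟨hj1, hj2⟩ := mem_Ico.1 hj
          refine abs_sub_le_variation f (mem_Icc.2 ?_) (mem_Icc.2 ?_) <;> constructor <;> linarith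
      _ = b * V := by
          rw [sum_const, Nat.card_Ico, add_one_mul, Nat.add_sub_cancel_left, nsmul_eq_mul]
  rw [haarCoef, abs_div, abs_of_nonneg (Real.sqrt_nonneg _)]
  refine div_le_of_le_mul₀ (Real.sqrt_nonneg _)
    (mul_nonneg (by positivity) (variation_nonneg _ _ _)) (halves.trans_eq ?_)
  linear_combination (-V / 2) * Real.sq_sqrt (show (0 : ℝ) ≤ 2 * b by positivity)

theorem sum_abs_haarCoef_le {J l : ℕ} (hl : l < J) (f : ℕ → ℝ) :
    √(2 ^ l) * ∑ i ∈ range (2 ^ l), |haarCoef (2 ^ (J - l - 1)) f i| ≤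
      √(2 ^ J) / 2 * variation f 0 (2 ^ J) := by
  have length : 2 ^ J = 2 ^ l * (2 * 2 ^ (J - l - 1)) := by
    rw [← pow_succ', ← pow_add]; congr 1; omega
  have blocks : ∑ i ∈ range (2 ^ l), variation f (i * (2 * 2 ^ (J - l - 1)))
      ((i + 1) * (2 * 2 ^ (J - l - 1))) = variation f 0 (2 ^ J) := by
    rw [length, variation, ← range_eq_Ico]
    exact sum_blockSum _ _ _
  have sqrt_length : √(2 ^ J) = √(2 ^ l) * √(2 * (2 ^ (J - l - 1) : ℕ)) := by
    rw [← Real.sqrt_mul (by positivity)]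
    exact congrArg Real.sqrt (by exact_mod_cast length)
  calc √(2 ^ l) * ∑ i ∈ range (2 ^ l), |haarCoef (2 ^ (J - l - 1)) f i|
      ≤ √(2 ^ l) * ∑ i ∈ range (2 ^ l), √(2 * (2 ^ (J - l - 1) : ℕ)) / 2 *
          variation f (i * (2 * 2 ^ (J - l - 1))) ((i + 1) * (2 * 2 ^ (J - l - 1))) := by
        gcongr with i
        exact abs_haarCoef_le _ f i
    _ = √(2 ^ J) / 2 * variation f 0 (2 ^ J) := by
        rw [← mul_sum, blocks, sqrt_length]; ring

/-! ### The rate `L^{1/3} V^{2/3}` and soft thresholding -/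

/-- The rate `L^{1/3} V^{2/3}` at which a sequence of length `L` and variation `V` is estimated. -/
noncomputable def tvRate (L V : ℝ) : ℝ := L ^ (1 / 3 : ℝ) * V ^ (2 / 3 : ℝ)

theorem tvRate_nonneg {L V : ℝ} (hL : 0 ≤ L) (hV : 0 ≤ V) : 0 ≤ tvRate L V :=
  mul_nonneg (Real.rpow_nonneg hL _) (Real.rpow_nonneg hV _)

theorem tvRate_mono {L L' V V' : ℝ} (hL : 0 ≤ L) (hLL' : L ≤ L') (hV : 0 ≤ V) (hVV' : V ≤ V') :
    tvRate L V ≤ tvRate L' V' := by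
  have := hL.trans hLL'
  unfold tvRate
  gcongr

theorem tvRate_eq_rpow {L V : ℝ} (hL : 0 ≤ L) (hV : 0 ≤ V) :
    tvRate L V = (√L * V) ^ (2 / 3 : ℝ) := by
  rw [tvRate, Real.mul_rpow (Real.sqrt_nonneg L) hV, Real.sqrt_eq_rpow, ← Real.rpow_mul hL]
  norm_num

theorem tvRate_two_mul_le {L V : ℝ} (hL : 0 ≤ L) (hV : 0 ≤ V) :
    tvRate (2 * L) V ≤ 2 * tvRate L V := by
  have two_rpow_le : (2 : ℝ) ^ (1 / 3 : ℝ) ≤ 2 :=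
    Real.rpow_le_self_of_one_le (by norm_num) (by norm_num)
  calc tvRate (2 * L) V = 2 ^ (1 / 3 : ℝ) * tvRate L V := by
        rw [tvRate, tvRate, Real.mul_rpow zero_le_two hL, mul_assoc]
    _ ≤ 2 * tvRate L V := mul_le_mul_of_nonneg_right two_rpow_le (tvRate_nonneg hL hV)

theorem sum_tvRate_le {ι : Type*} (s : Finset ι) {x y : ι → ℝ}
    (hx : ∀ i ∈ s, 0 ≤ x i) (hy : ∀ i ∈ s, 0 ≤ y i) :
    ∑ i ∈ s, tvRate (x i) (y i) ≤ tvRate (∑ i ∈ s, x i) (∑ i ∈ s, y i) := by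
  have conj : (3 : ℝ).HolderConjugate (3 / 2) := by
    rw [Real.holderConjugate_iff]; norm_num
  have holder := Real.inner_le_Lp_mul_Lq_of_nonneg s conj
    (fun i hi => Real.rpow_nonneg (hx i hi) (1 / 3))
    (fun i hi => Real.rpow_nonneg (hy i hi) (2 / 3))
  have cubes : ∑ i ∈ s, (x i ^ (1 / 3 : ℝ)) ^ (3 : ℝ) = ∑ i ∈ s, x i :=
    sum_congr rfl fun i hi => by rw [← Real.rpow_mul (hx i hi)]; norm_num
  have powers : ∑ i ∈ s, (y i ^ (2 / 3 : ℝ)) ^ (3 / 2 : ℝ) = ∑ i ∈ s, y i :=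
    sum_congr rfl fun i hi => by rw [← Real.rpow_mul (hy i hi)]; norm_num
  rwa [cubes, powers, show (1 / (3 / 2) : ℝ) = 2 / 3 by norm_num] at holder

theorem rpow_four_thirds_mul_rpow_two_thirds {x : ℝ} (hx : 0 ≤ x) :
    x ^ (4 / 3 : ℝ) * x ^ (2 / 3 : ℝ) = x ^ 2 := by
  rw [← Real.rpow_add_of_nonneg hx (by norm_num) (by norm_num), ← Real.rpow_natCast]
  norm_num

theorem abs_softThreshold {lam : ℝ} (hlam : 0 ≤ lam) (x : ℝ) :
    |softThreshold lam x| = max (|x| - lam) 0 := by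
  have max_nonneg := le_max_right (|x| - lam) 0
  unfold softThreshold
  rcases lt_trichotomy x 0 with hx | rfl | hx
  · rw [Real.sign_of_neg hx, neg_one_mul, abs_neg, abs_of_nonneg max_nonneg]
  · simp [hlam]
  · rw [Real.sign_of_pos hx, one_mul, abs_of_nonneg max_nonneg]

theorem abs_softThreshold_add_le {lam a e : ℝ} (he : |e| ≤ lam) :
    |softThreshold lam (a + e)| ≤ |a| := by
  rw [abs_softThreshold ((abs_nonneg e).trans he)]
  have := abs_add_le a e
  exact max_le (by linarith) (abs_nonneg a)

theorem sq_le_softThreshold_add {lam a e : ℝ} (he : |e| ≤ lam) :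
    a ^ 2 ≤ 4 * |softThreshold lam (a + e)| ^ 2 +
      (4 * lam) ^ (4 / 3 : ℝ) * |a| ^ (2 / 3 : ℝ) := by
  have hlam : 0 ≤ lam := (abs_nonneg e).trans he
  rcases le_total |a| (4 * lam) with small | large
  · calc a ^ 2 = |a| ^ (4 / 3 : ℝ) * |a| ^ (2 / 3 : ℝ) := by
          rw [rpow_four_thirds_mul_rpow_two_thirds (abs_nonneg a), sq_abs]
      _ ≤ (4 * lam) ^ (4 / 3 : ℝ) * |a| ^ (2 / 3 : ℝ) := by gcongr
      _ ≤ _ := le_add_of_nonneg_left (by positivity)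
  · have triangle : |a| ≤ |a + e| + |e| := by simpa using abs_sub (a + e) e
    have half_le : |a| / 2 ≤ |softThreshold lam (a + e)| := by
      rw [abs_softThreshold hlam]
      exact le_max_of_le_left (by linarith)
    calc a ^ 2 = 4 * (|a| / 2) ^ 2 := by rw [div_pow, sq_abs]; ring
      _ ≤ 4 * |softThreshold lam (a + e)| ^ 2 := by gcongr
      _ ≤ _ := le_add_of_nonneg_right (by positivity)

/-! ### Averages -/

theorem length_pos {a b : ℕ} (hab : a ≤ b) : (0 : ℝ) < (b + 1 - a : ℕ) := by
  exact_mod_cast (by omega : 0 < b + 1 - a)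

theorem avg_mul_length (y : ℕ → ℝ) {a b : ℕ} (hab : a ≤ b) :
    ((b + 1 - a : ℕ) : ℝ) * avg y a b = ∑ s ∈ Icc a b, y s :=
  mul_div_cancel₀ _ (length_pos hab).ne'

theorem avg_add (y z : ℕ → ℝ) (a b : ℕ) : avg (y + z) a b = avg y a b + avg z a b := by
  simp only [avg, Pi.add_apply, sum_add_distrib, add_div]

theorem avg_smul (c : ℝ) (y : ℕ → ℝ) (a b : ℕ) : avg (c • y) a b = c * avg y a b := by
  simp only [avg, Pi.smul_apply, smul_eq_mul, ← mul_sum, mul_div_assoc]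

theorem sum_const_sub (y : ℕ → ℝ) {a b : ℕ} (hab : a ≤ b) (c : ℝ) :
    ∑ t ∈ Icc a b, (c - y t) = ((b + 1 - a : ℕ) : ℝ) * (c - avg y a b) := by
  rw [mul_sub, avg_mul_length y hab, sum_sub_distrib, sum_const, Nat.card_Icc, nsmul_eq_mul]

theorem abs_sub_avg_le (y : ℕ → ℝ) {a b : ℕ} (hab : a ≤ b) {c V : ℝ}
    (hV : ∀ s ∈ Icc a b, |c - y s| ≤ V) : |c - avg y a b| ≤ V := by
  refine le_of_mul_le_mul_left ?_ (length_pos hab)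
  calc ((b + 1 - a : ℕ) : ℝ) * |c - avg y a b| = |∑ s ∈ Icc a b, (c - y s)| := by
        rw [sum_const_sub y hab, abs_mul, Nat.abs_cast]
    _ ≤ ∑ s ∈ Icc a b, |c - y s| := abs_sum_le_sum_abs _ _
    _ ≤ ((b + 1 - a : ℕ) : ℝ) * V := by
        refine (sum_le_card_nsmul _ _ _ hV).trans_eq ?_
        rw [Nat.card_Icc, nsmul_eq_mul]

theorem sum_sq_sub_avg (y : ℕ → ℝ) {a b : ℕ} (hab : a ≤ b) :
    ∑ t ∈ Icc a b, (y t - avg y a b) ^ 2 =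
      ∑ t ∈ Icc a b, y t ^ 2 - ((b + 1 - a : ℕ) : ℝ) * avg y a b ^ 2 := by
  simp only [sub_sq, sum_add_distrib, sum_sub_distrib, ← sum_mul, ← mul_sum, sum_const,
    Nat.card_Icc, nsmul_eq_mul, ← avg_mul_length y hab]
  ring

theorem sum_sq_sub_avg_succ (y : ℕ → ℝ) {a b : ℕ} (hab : a ≤ b) :
    ∑ t ∈ Icc a (b + 1), (y t - avg y a (b + 1)) ^ 2 =
      ∑ t ∈ Icc a b, (y t - avg y a b) ^ 2 +
        ((b + 1 - a : ℕ) : ℝ) / ((b + 1 - a : ℕ) + 1) * (y (b + 1) - avg y a b) ^ 2 := by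
  have hab' : a ≤ b + 1 := Nat.le_succ_of_le hab
  have length_succ : ((b + 1 + 1 - a : ℕ) : ℝ) = ((b + 1 - a : ℕ) : ℝ) + 1 := by
    exact_mod_cast Nat.succ_sub hab'
  have := length_pos hab
  have mean_succ : avg y a (b + 1) =
      (((b + 1 - a : ℕ) : ℝ) * avg y a b + y (b + 1)) / ((b + 1 - a : ℕ) + 1) := by
    rw [eq_div_iff (by positivity), mul_comm, ← length_succ, avg_mul_length y hab',
      sum_Icc_succ_top hab', avg_mul_length y hab]
  rw [sum_sq_sub_avg y hab', sum_sq_sub_avg y hab, sum_Icc_succ_top hab', length_succ, mean_succ]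
  field_simp
  ring

theorem sum_sq_sub_running_avg_le (y : ℕ → ℝ) {a b : ℕ} (hab : a ≤ b) :
    ∑ t ∈ Ioc a b, (y t - avg y a (t - 1)) ^ 2 ≤ 2 * ∑ t ∈ Icc a b, (y t - avg y a b) ^ 2 := by
  induction b, hab using Nat.le_induction with
  | base => simp [sq_nonneg]
  | succ b hab ih =>
    have half_le : (1 : ℝ) / 2 ≤ ((b + 1 - a : ℕ) : ℝ) / ((b + 1 - a : ℕ) + 1) := by
      have : (1 : ℝ) ≤ (b + 1 - a : ℕ) := by exact_mod_cast (by omega : 1 ≤ b + 1 - a)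
      rw [div_le_div_iff₀ (by norm_num) (by positivity)]
      linarith
    rw [sum_Ioc_succ_top hab, sum_sq_sub_avg_succ y hab, Nat.add_sub_cancel]
    linarith [mul_le_mul_of_nonneg_right half_le (sq_nonneg (y (b + 1) - avg y a b))]

/-! ### Haar coefficients of a segment -/

/-- The sequence `y a, …, y b`, recentred by its average and continued by zeros: `pad0` with
natural numbers as indices. -/
noncomputable def padSeq (y : ℕ → ℝ) (a b : ℕ) : ℕ → ℝ :=
  fun j => if a + j ≤ b then y (a + j) - avg y a b else 0

/-- The Haar coefficient of level `l` at position `i` of the recentred and padded segment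
`y a, …, y b`, as a linear functional of the whole sequence `y`. -/
noncomputable def segCoef (a b l i : ℕ) : (ℕ → ℝ) →ₗ[ℝ] ℝ where
  toFun y := haarCoef (2 ^ (padExp a b - l - 1)) (padSeq y a b) i
  map_add' y z := by
    have padSeq_add : padSeq (y + z) a b = padSeq y a b + padSeq z a b := by
      ext j
      simp only [padSeq, avg_add, Pi.add_apply]
      split_ifs <;> ring
    simp only [padSeq_add, haarCoef, blockSum, Pi.add_apply, sum_add_distrib]
    ring
  map_smul' c y := by
    have padSeq_smul : padSeq (c • y) a b = c • padSeq y a b := by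
      ext j
      simp only [padSeq, avg_smul, Pi.smul_apply, smul_eq_mul]
      split_ifs <;> ring
    simp only [padSeq_smul, haarCoef, blockSum, Pi.smul_apply, smul_eq_mul, ← mul_sum,
      RingHom.id_apply]
    ring

theorem length_le_two_pow_padExp (a b : ℕ) : b + 1 - a ≤ 2 ^ padExp a b :=
  Nat.le_pow_clog (by norm_num) _

theorem two_pow_padExp_le {a b : ℕ} (hab : a ≤ b) : 2 ^ padExp a b ≤ 2 * (b + 1 - a) := by
  rcases hab.eq_or_lt with rfl | hab
  · simp [padExp]
  · have half_lt := Nat.pow_pred_clog_lt_self (b := 2) (by norm_num) (by omega : 1 < b + 1 - a)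
    have clog_pos : 0 < Nat.clog 2 (b + 1 - a) := Nat.clog_pos (by norm_num) (by omega)
    rw [padExp, ← Nat.succ_pred_eq_of_pos clog_pos, pow_succ']
    omega

theorem sum_range_ite_eq_sum_Icc (g : ℕ → ℝ) {a b M : ℕ} (hM : b + 1 - a ≤ M) :
    ∑ j ∈ range M, (if a + j ≤ b then g (a + j) else 0) = ∑ t ∈ Icc a b, g t := by
  have shifted : ∑ t ∈ Icc a b, g t = ∑ j ∈ range (b + 1 - a), g (a + j) := by
    rw [← sum_Ico_eq_sum_range]; rfl
  rw [← sum_filter, shifted]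
  refine sum_congr ?_ fun _ _ => rfl
  ext j
  simp only [mem_filter, mem_range]
  omega

theorem sum_padSeq (y : ℕ → ℝ) {a b : ℕ} (hab : a ≤ b) :
    ∑ j ∈ range (2 ^ padExp a b), padSeq y a b j = 0 := by
  unfold padSeq
  rw [sum_range_ite_eq_sum_Icc (fun t => y t - avg y a b) (length_le_two_pow_padExp a b),
    sum_sub_distrib, ← avg_mul_length y hab, sum_const, Nat.card_Icc, nsmul_eq_mul, sub_self]

theorem sum_padSeq_sq (y : ℕ → ℝ) (a b : ℕ) :
    ∑ j ∈ range (2 ^ padExp a b), padSeq y a b j ^ 2 = ∑ t ∈ Icc a b, (y t - avg y a b) ^ 2 := by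
  rw [← sum_range_ite_eq_sum_Icc (fun t => (y t - avg y a b) ^ 2) (length_le_two_pow_padExp a b)]
  simp only [padSeq, ite_pow, zero_pow two_ne_zero]

theorem sum_sq_sub_avg_eq_sum_segCoef_sq (y : ℕ → ℝ) {a b : ℕ} (hab : a ≤ b) :
    ∑ t ∈ Icc a b, (y t - avg y a b) ^ 2 =
      ∑ l ∈ range (padExp a b), ∑ i ∈ range (2 ^ l), segCoef a b l i y ^ 2 := by
  rw [← sum_padSeq_sq, sum_sq_eq_sum_haarCoef_sq, sum_padSeq y hab]
  simp [segCoef]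

theorem segCoef_sq_le {a b l i : ℕ} (hab : a ≤ b) (hl : l < padExp a b) (hi : i < 2 ^ l)
    (y : ℕ → ℝ) : segCoef a b l i y ^ 2 ≤ ∑ t ∈ Icc a b, y t ^ 2 :=
  calc segCoef a b l i y ^ 2 ≤ ∑ i ∈ range (2 ^ l), segCoef a b l i y ^ 2 :=
        single_le_sum (f := fun i => segCoef a b l i y ^ 2) (fun _ _ => sq_nonneg _)
          (mem_range.2 hi)
    _ ≤ ∑ l ∈ range (padExp a b), ∑ i ∈ range (2 ^ l), segCoef a b l i y ^ 2 :=
        single_le_sum (f := fun l => ∑ i ∈ range (2 ^ l), segCoef a b l i y ^ 2)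
          (fun _ _ => sum_nonneg fun _ _ => sq_nonneg _) (mem_range.2 hl)
    _ = ∑ t ∈ Icc a b, y t ^ 2 - ((b + 1 - a : ℕ) : ℝ) * avg y a b ^ 2 := by
        rw [← sum_sq_sub_avg_eq_sum_segCoef_sq y hab, sum_sq_sub_avg y hab]
    _ ≤ ∑ t ∈ Icc a b, y t ^ 2 := sub_le_self _ (by positivity)

-- Recentring makes the jump to the padding at the end at most the variation of the segment.
theorem variation_padSeq_le (θ : ℕ → ℝ) {a b : ℕ} (hab : a ≤ b) :
    variation (padSeq θ a b) 0 (2 ^ padExp a b) ≤ 2 * variation θ a b := by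
  obtain ⟨d, rfl⟩ := Nat.exists_eq_add_of_le hab
  set p := padSeq θ a (a + d)
  have p_inside : ∀ u ≤ d, p u = θ (a + u) - avg θ a (a + d) := fun u hu => if_pos (by omega)
  have p_outside : ∀ u, d < u → p u = 0 := fun u hu => if_neg (by omega)
  have fits : d + 1 ≤ 2 ^ padExp a (a + d) := by
    have := length_le_two_pow_padExp a (a + d)
    omega
  have inner : ∑ u ∈ Ico 0 d, |p (u + 1) - p u| = variation θ a (a + d) := by
    rw [variation, sum_Ico_eq_sum_range _ a, Nat.add_sub_cancel_left, ← range_eq_Ico]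
    refine sum_congr rfl fun u hu => ?_
    have := mem_range.1 hu
    rw [p_inside u (by omega), p_inside (u + 1) (by omega), sub_sub_sub_cancel_right, add_assoc]
  have boundary_jump : |p (d + 1) - p d| ≤ variation θ a (a + d) := by
    rw [p_outside (d + 1) (by omega), p_inside d le_rfl, zero_sub, abs_neg]
    exact abs_sub_avg_le θ hab fun s hs => abs_sub_le_variation θ (right_mem_Icc.2 hab) hs
  have padding : ∑ u ∈ Ico (d + 1) (2 ^ padExp a (a + d)), |p (u + 1) - p u| = 0 := by
    refine sum_eq_zero fun u hu => ?_
    have := (mem_Ico.1 hu).1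
    rw [p_outside u (by omega), p_outside (u + 1) (by omega), sub_zero, abs_zero]
  rw [variation, ← sum_Ico_consecutive _ (Nat.zero_le _) fits, sum_Ico_succ_top (Nat.zero_le _),
    inner, padding]
  linarith

theorem sum_abs_segCoef_le (θ : ℕ → ℝ) {a b l : ℕ} (hab : a ≤ b) (hl : l < padExp a b) :
    √(2 ^ l) * ∑ i ∈ range (2 ^ l), |segCoef a b l i θ| ≤
      √(2 ^ padExp a b) * variation θ a b :=
  calc √(2 ^ l) * ∑ i ∈ range (2 ^ l), |segCoef a b l i θ|
      ≤ √(2 ^ padExp a b) / 2 * variation (padSeq θ a b) 0 (2 ^ padExp a b) :=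
        sum_abs_haarCoef_le hl _
    _ ≤ √(2 ^ padExp a b) / 2 * (2 * variation θ a b) := by
        gcongr
        exact variation_padSeq_le θ hab
    _ = √(2 ^ padExp a b) * variation θ a b := by ring

theorem sum_rpow_abs_segCoef_le (θ : ℕ → ℝ) {a b l : ℕ} (hab : a ≤ b) (hl : l < padExp a b) :
    ∑ i ∈ range (2 ^ l), |segCoef a b l i θ| ^ (2 / 3 : ℝ) ≤
      tvRate (2 ^ padExp a b) (variation θ a b) := by
  have sum_nonneg : 0 ≤ ∑ i ∈ range (2 ^ l), |segCoef a b l i θ| :=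
    sum_nonneg fun _ _ => abs_nonneg _
  calc ∑ i ∈ range (2 ^ l), |segCoef a b l i θ| ^ (2 / 3 : ℝ)
      = ∑ i ∈ range (2 ^ l), tvRate 1 |segCoef a b l i θ| := by
        simp only [tvRate, Real.one_rpow, one_mul]
    _ ≤ tvRate (2 ^ l) (∑ i ∈ range (2 ^ l), |segCoef a b l i θ|) := by
        refine (sum_tvRate_le _ (fun _ _ => zero_le_one) fun _ _ => abs_nonneg _).trans_eq ?_
        rw [sum_const, card_range, nsmul_eq_mul, mul_one, Nat.cast_pow, Nat.cast_ofNat]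
    _ = (√(2 ^ l) * ∑ i ∈ range (2 ^ l), |segCoef a b l i θ|) ^ (2 / 3 : ℝ) :=
        tvRate_eq_rpow (by positivity) sum_nonneg
    _ ≤ (√(2 ^ padExp a b) * variation θ a b) ^ (2 / 3 : ℝ) :=
        Real.rpow_le_rpow (by positivity) (sum_abs_segCoef_le θ hab hl) (by norm_num)
    _ = tvRate (2 ^ padExp a b) (variation θ a b) :=
        (tvRate_eq_rpow (by positivity) (variation_nonneg _ _ _)).symm

/-! ### The restart statistic -/

/-- The threshold `σ √(β log n)` of ARROWS. -/
noncomputable def threshold (n : ℕ) (σ β : ℝ) : ℝ := σ * √(β * Real.log n)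

/-- The quantity `∑ₗ 2^{l/2} ‖T(H pad₀(y a, …, y b))[l]‖₁`, at soft threshold `lam`, that the
restart rule compares with `σ`. -/
noncomputable def restartStat (lam : ℝ) (y : ℕ → ℝ) (a b : ℕ) : ℝ :=
  ∑ l ∈ range (padExp a b), √(2 ^ l) *
    ∑ i ∈ range (2 ^ l), |softThreshold lam (segCoef a b l i y)|

theorem restartStat_nonneg (lam : ℝ) (y : ℕ → ℝ) (a b : ℕ) : 0 ≤ restartStat lam y a b :=
  sum_nonneg fun _ _ => mul_nonneg (Real.sqrt_nonneg _) (sum_nonneg fun _ _ => abs_nonneg _)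

theorem restart_iff (n : ℕ) (σ β : ℝ) (y : ℕ → ℝ) (a b : ℕ) :
    Restart n σ β y a b ↔ σ < restartStat (threshold n σ β) y a b := by
  have level_eq : ∀ l ∈ range (padExp a b), √(2 ^ l) * levelNorm (coeffs n σ β y a b) l =
      √(2 ^ l) * ∑ i ∈ range (2 ^ l), |softThreshold (threshold n σ β) (segCoef a b l i y)| := by
    intro l hl
    have hl := mem_range.1 hl
    rw [levelNorm_eq_sum_range hl]
    exact fun i hi r hr => congrArg (softThreshold _) (haarMatrix_mulVec hl hi hr (padSeq y a b))
  rw [Restart, sum_congr rfl level_eq, one_div_mul_eq_div,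
    div_lt_div_iff_of_pos_right (by positivity), restartStat]

theorem sum_sq_softThreshold_le (lam : ℝ) (y : ℕ → ℝ) (a b : ℕ) :
    ∑ l ∈ range (padExp a b), ∑ i ∈ range (2 ^ l), |softThreshold lam (segCoef a b l i y)| ^ 2 ≤
      restartStat lam y a b ^ 2 := by
  have level_le : ∀ l, ∑ i ∈ range (2 ^ l), |softThreshold lam (segCoef a b l i y)| ^ 2 ≤
      (√(2 ^ l) * ∑ i ∈ range (2 ^ l), |softThreshold lam (segCoef a b l i y)|) ^ 2 := by
    intro l
    refine (sum_sq_le_sq_sum_of_nonneg fun _ _ => abs_nonneg _).trans ?_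
    rw [mul_pow, Real.sq_sqrt (by positivity)]
    exact le_mul_of_one_le_left (sq_nonneg _) (one_le_pow₀ one_le_two)
  exact (sum_le_sum fun l _ => level_le l).trans (sum_sq_le_sq_sum_of_nonneg fun _ _ =>
    mul_nonneg (Real.sqrt_nonneg _) (sum_nonneg fun _ _ => abs_nonneg _))

section Segment

variable {lam : ℝ} {θ z : ℕ → ℝ} {a b : ℕ}

theorem restartStat_add_le (hab : a ≤ b)
    (hz : ∀ l < padExp a b, ∀ i < 2 ^ l, |segCoef a b l i z| ≤ lam) :
    restartStat lam (θ + z) a b ≤ padExp a b * (√(2 ^ padExp a b) * variation θ a b) := by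
  have level_le : ∀ l ∈ range (padExp a b),
      √(2 ^ l) * ∑ i ∈ range (2 ^ l), |softThreshold lam (segCoef a b l i (θ + z))| ≤
        √(2 ^ padExp a b) * variation θ a b := by
    intro l hl
    have hl := mem_range.1 hl
    refine le_trans ?_ (sum_abs_segCoef_le θ hab hl)
    refine mul_le_mul_of_nonneg_left (sum_le_sum fun i hi => ?_) (Real.sqrt_nonneg _)
    rw [map_add]
    exact abs_softThreshold_add_le (hz l hl i (mem_range.1 hi))
  refine (sum_le_card_nsmul _ _ _ level_le).trans_eq ?_
  rw [card_range, nsmul_eq_mul]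

theorem sum_sq_sub_avg_le_restartStat (hab : a ≤ b) (hlam : 0 ≤ lam)
    (hz : ∀ l < padExp a b, ∀ i < 2 ^ l, |segCoef a b l i z| ≤ lam) :
    ∑ t ∈ Icc a b, (θ t - avg θ a b) ^ 2 ≤ 4 * restartStat lam (θ + z) a b ^ 2 +
      (4 * lam) ^ (4 / 3 : ℝ) * (padExp a b * tvRate (2 ^ padExp a b) (variation θ a b)) := by
  have coef_sq_le : ∀ l ∈ range (padExp a b), ∀ i ∈ range (2 ^ l), segCoef a b l i θ ^ 2 ≤
      4 * |softThreshold lam (segCoef a b l i (θ + z))| ^ 2 +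
        (4 * lam) ^ (4 / 3 : ℝ) * |segCoef a b l i θ| ^ (2 / 3 : ℝ) := by
    intro l hl i hi
    rw [map_add]
    exact sq_le_softThreshold_add (hz l (mem_range.1 hl) i (mem_range.1 hi))
  have rate : ∑ l ∈ range (padExp a b), ∑ i ∈ range (2 ^ l), |segCoef a b l i θ| ^ (2 / 3 : ℝ) ≤
      padExp a b * tvRate (2 ^ padExp a b) (variation θ a b) := by
    refine (sum_le_card_nsmul _ _ _ fun l hl =>
      sum_rpow_abs_segCoef_le θ hab (mem_range.1 hl)).trans_eq ?_
    rw [card_range, nsmul_eq_mul]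
  rw [sum_sq_sub_avg_eq_sum_segCoef_sq θ hab]
  refine (sum_le_sum fun l hl => sum_le_sum (coef_sq_le l hl)).trans ?_
  simp only [sum_add_distrib, ← mul_sum]
  gcongr
  exact sum_sq_softThreshold_le lam (θ + z) a b

theorem sq_le_of_restart {n : ℕ} {σ β : ℝ} (hσ : 0 ≤ σ) (hab : a ≤ b)
    (hz : ∀ l < padExp a b, ∀ i < 2 ^ l, |segCoef a b l i z| ≤ threshold n σ β)
    (hr : Restart n σ β (θ + z) a b) :
    σ ^ 2 ≤ σ ^ (4 / 3 : ℝ) *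
      (padExp a b * tvRate (2 ^ padExp a b) (variation θ a b)) := by
  have variation_nonneg := variation_nonneg θ a b
  have σ_le := ((restart_iff n σ β _ a b).1 hr).le.trans (restartStat_add_le hab hz)
  have rpow_le_self : (padExp a b : ℝ) ^ (2 / 3 : ℝ) ≤ padExp a b := by
    rcases Nat.eq_zero_or_pos (padExp a b) with zero | pos
    · simp [zero]
    · exact Real.rpow_le_self_of_one_le (by exact_mod_cast pos) (by norm_num)
  calc σ ^ 2 = σ ^ (4 / 3 : ℝ) * σ ^ (2 / 3 : ℝ) :=
        (rpow_four_thirds_mul_rpow_two_thirds hσ).symm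
    _ ≤ σ ^ (4 / 3 : ℝ) *
          (padExp a b * (√(2 ^ padExp a b) * variation θ a b)) ^ (2 / 3 : ℝ) := by gcongr
    _ = σ ^ (4 / 3 : ℝ) * ((padExp a b : ℝ) ^ (2 / 3 : ℝ) *
          tvRate (2 ^ padExp a b) (variation θ a b)) := by
        rw [Real.mul_rpow (by positivity) (by positivity),
          tvRate_eq_rpow (by positivity) variation_nonneg]
    _ ≤ _ := by
        have := tvRate_nonneg (L := 2 ^ padExp a b) (by positivity) variation_nonneg
        gcongr

end Segment

/-! ### Contractive functionals of subgaussian noise -/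

theorem exists_weights_of_sq_le_sum_sq {κ : Type*} (s : Finset κ) (T : (κ → ℝ) →ₗ[ℝ] ℝ)
    (hT : ∀ z, T z ^ 2 ≤ ∑ i ∈ s, z i ^ 2) :
    ∃ w : κ → ℝ, ∑ i ∈ s, w i ^ 2 ≤ 1 ∧ ∀ z, T z = ∑ i ∈ s, w i * z i := by
  classical
  set w : κ → ℝ := fun i => T (Pi.single i 1)
  have T_eq : ∀ z, T z = ∑ i ∈ s, w i * z i := by
    intro z
    set z' : κ → ℝ := ∑ i ∈ s, z i • Pi.single i 1
    have z'_eq : ∀ i ∈ s, z' i = z i := fun i hi => by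
      simp [z', Finset.sum_apply, Pi.single_apply, hi]
    have T_sub : T (z - z') = 0 := by
      refine sq_nonpos_iff _ |>.1 ((hT _).trans (sum_nonpos fun i hi => ?_))
      rw [Pi.sub_apply, z'_eq i hi, sub_self, zero_pow two_ne_zero]
    rw [← sub_add_cancel z z', map_add, T_sub, zero_add, map_sum]
    exact sum_congr rfl fun i _ => by
      rw [map_smul, smul_eq_mul, mul_comm, sub_add_cancel]
  have T_w : T w = ∑ i ∈ s, w i ^ 2 := by simp only [T_eq w, sq]
  have sum_sq_nonneg : 0 ≤ ∑ i ∈ s, w i ^ 2 := sum_nonneg fun _ _ => sq_nonneg _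
  have sq_le := hT w
  rw [T_w] at sq_le
  exact ⟨w, by nlinarith [sum_sq_nonneg], T_eq⟩

section Probability

open MeasureTheory ProbabilityTheory
open scoped NNReal

variable {Ω κ : Type*} [MeasurableSpace Ω] {μ : Measure Ω} {X : Ω → ℝ} {σ : ℝ≥0}

theorem hasSubgaussianMGF_mono {c c' : ℝ≥0} (hX : HasSubgaussianMGF X c μ) (hc : c ≤ c') :
    HasSubgaussianMGF X c' μ where
  integrable_exp_mul := hX.integrable_exp_mul
  mgf_le t := (hX.mgf_le t).trans (by gcongr)

theorem hasSubgaussianMGF_of_sq_le_sum_sq {c : ℝ≥0} {s : Finset κ} {Z : κ → Ω → ℝ}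
    (hindep : iIndepFun (fun i : s => Z i) μ) (hZ : ∀ i ∈ s, HasSubgaussianMGF (Z i) c μ)
    {T : (κ → ℝ) →ₗ[ℝ] ℝ} (hT : ∀ z, T z ^ 2 ≤ ∑ i ∈ s, z i ^ 2) :
    HasSubgaussianMGF (fun ω => T (fun i => Z i ω)) c μ := by
  obtain ⟨w, sum_sq_le, T_eq⟩ := exists_weights_of_sq_le_sum_sq s T hT
  have weighted_indep : iIndepFun (fun (i : s) ω => w i * Z i ω) μ :=
    hindep.comp (fun i x => w i * x) fun i => measurable_const_mul _
  have weighted_sum := HasSubgaussianMGF.sum_of_iIndepFun weighted_indep (s := univ)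
    fun i _ => (hZ i i.2).const_mul (w i)
  have proxy_le : ∑ i : s, NNReal.mk (w i ^ 2) (sq_nonneg _) * c ≤ c := by
    rw [← sum_mul]
    refine mul_le_of_le_one_left c.2 ?_
    rw [← NNReal.coe_le_coe, NNReal.coe_sum, NNReal.coe_one]
    exact (sum_coe_sort s fun i => w i ^ 2).trans_le sum_sq_le
  refine (hasSubgaussianMGF_mono weighted_sum proxy_le).congr (Filter.Eventually.of_forall ?_)
  intro ω
  exact (sum_coe_sort s fun i => w i * Z i ω).trans (T_eq _).symm

theorem measureReal_lt_abs_le [IsFiniteMeasure μ] (hX : HasSubgaussianMGF X (σ ^ 2) μ) {x : ℝ}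
    (hx : 0 ≤ x) : μ.real {ω | σ * x < |X ω|} ≤ 2 * Real.exp (-x ^ 2 / 2) := by
  rcases eq_or_ne σ 0 with rfl | σ_ne_zero
  · have X_eq_zero := HasSubgaussianMGF.ae_eq_zero_of_hasSubgaussianMGF_zero (by simpa using hX)
    have subset_null : {ω | (0 : ℝ≥0) * x < |X ω|} ⊆ {ω | ¬X ω = (0 : Ω → ℝ) ω} := by
      intro ω hω hXω
      simp [hXω] at hω
    have null := measure_mono_null subset_null (ae_iff.1 X_eq_zero)
    rw [measureReal_def, null]
    positivity
  have exponent : -(σ * x) ^ 2 / (2 * (σ ^ 2 : ℝ≥0)) = -x ^ 2 / 2 := by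
    have : (σ : ℝ) ≠ 0 := NNReal.coe_ne_zero.2 σ_ne_zero
    push_cast
    field_simp
  have upper := hX.measure_ge_le (ε := σ * x) (by positivity)
  have lower := hX.neg.measure_ge_le (ε := σ * x) (by positivity)
  rw [exponent] at upper lower
  calc μ.real {ω | σ * x < |X ω|}
      ≤ μ.real ({ω | σ * x ≤ X ω} ∪ {ω | σ * x ≤ (-X) ω}) :=
        measureReal_mono fun ω hω =>
          (lt_abs.1 (show σ * x < |X ω| from hω)).imp (fun h => h.le) (fun h => h.le)
    _ ≤ 2 * Real.exp (-x ^ 2 / 2) := by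
        rw [two_mul]
        exact (measureReal_union_le _ _).trans (add_le_add upper lower)

theorem one_sub_le_measureReal_forall_abs_le [IsProbabilityMeasure μ] {s : Finset κ}
    {Z : κ → Ω → ℝ} (hindep : iIndepFun (fun i : s => Z i) μ)
    (hZ : ∀ i ∈ s, HasSubgaussianMGF (Z i) (σ ^ 2) μ) {𝒯 : Finset ((κ → ℝ) →ₗ[ℝ] ℝ)}
    (h𝒯 : ∀ T ∈ 𝒯, ∀ z, T z ^ 2 ≤ ∑ i ∈ s, z i ^ 2) {x : ℝ} (hx : 0 ≤ x) :
    1 - #𝒯 * (2 * Real.exp (-x ^ 2 / 2)) ≤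
      μ.real {ω | ∀ T ∈ 𝒯, |T (fun i => Z i ω)| ≤ σ * x} := by
  set good := {ω | ∀ T ∈ 𝒯, |T (fun i => Z i ω)| ≤ σ * x}
  have bad_eq : goodᶜ = ⋃ T ∈ 𝒯, {ω | σ * x < |T (fun i => Z i ω)|} := by
    ext ω
    simp [good]
  have bad_le : μ.real goodᶜ ≤ #𝒯 * (2 * Real.exp (-x ^ 2 / 2)) := by
    rw [bad_eq, ← nsmul_eq_mul]
    exact (measureReal_biUnion_finset_le _ _).trans (sum_le_card_nsmul _ _ _ fun T hT =>
      measureReal_lt_abs_le (hasSubgaussianMGF_of_sq_le_sum_sq hindep hZ (h𝒯 T hT)) hx)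
  have total : 1 ≤ μ.real good + μ.real goodᶜ := by
    rw [← probReal_univ (μ := μ), ← Set.union_compl_self good]
    exact measureReal_union_le _ _
  linarith

end Probability

/-! ### The good event -/

/-- The sum of `z a, …, z b` divided by the square root of the number of terms. -/
noncomputable def segSum (a b : ℕ) : (ℕ → ℝ) →ₗ[ℝ] ℝ :=
  (√(b + 1 - a : ℕ))⁻¹ • ∑ t ∈ Icc a b, LinearMap.proj t

open Classical in
/-- The contractive functionals of the noise that the analysis of ARROWS needs to control: the
normalized sums and the Haar coefficients of all segments of `1, …, n`. -/
noncomputable def testFunctionals (n : ℕ) : Finset ((ℕ → ℝ) →ₗ[ℝ] ℝ) :=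
  {q ∈ Icc 1 n ×ˢ Icc 1 n | q.1 ≤ q.2}.biUnion fun q =>
    insert (segSum q.1 q.2) ((range (padExp q.1 q.2)).biUnion fun l =>
      (range (2 ^ l)).image fun i => segCoef q.1 q.2 l i)

/-- The event of the analysis of ARROWS: `lam` bounds all the `testFunctionals` of the noise. -/
def IsGoodNoise (n : ℕ) (lam : ℝ) (z : ℕ → ℝ) : Prop :=
  ∀ T ∈ testFunctionals n, |T z| ≤ lam

/-- The input `β` of ARROWS at confidence level `1 - δ`. -/
noncomputable def arrowsBeta (n : ℕ) (δ : ℝ) : ℝ := 24 + 8 * Real.log (8 / δ) / Real.log n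

theorem segSum_apply (a b : ℕ) (z : ℕ → ℝ) :
    segSum a b z = (∑ t ∈ Icc a b, z t) / √(b + 1 - a : ℕ) := by
  simp [segSum, div_eq_inv_mul]

theorem segSum_sq_le (a b : ℕ) (z : ℕ → ℝ) : segSum a b z ^ 2 ≤ ∑ t ∈ Icc a b, z t ^ 2 := by
  rw [segSum_apply, div_pow, Real.sq_sqrt (Nat.cast_nonneg _), ← Nat.card_Icc]
  exact div_le_of_le_mul₀ (Nat.cast_nonneg _) (sum_nonneg fun _ _ => sq_nonneg _)
    (sq_sum_le_card_mul_sum_sq.trans_eq (mul_comm _ _))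

theorem mem_testFunctionals {n : ℕ} {T : (ℕ → ℝ) →ₗ[ℝ] ℝ} :
    T ∈ testFunctionals n ↔ ∃ a b, 1 ≤ a ∧ a ≤ b ∧ b ≤ n ∧
      (T = segSum a b ∨ ∃ l < padExp a b, ∃ i < 2 ^ l, segCoef a b l i = T) := by
  simp only [testFunctionals, mem_biUnion, mem_filter, mem_product, mem_Icc, mem_insert, mem_image,
    mem_range, Prod.exists]
  refine exists₂_congr fun a b => ⟨?_, ?_⟩
  · rintro ⟨⟨⟨⟨ha, -⟩, -, hb⟩, hab⟩, hT⟩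
    exact ⟨ha, hab, hb, hT⟩
  · rintro ⟨ha, hab, hb, hT⟩
    exact ⟨⟨⟨⟨ha, hab.trans hb⟩, ha.trans hab, hb⟩, hab⟩, hT⟩

theorem sq_le_of_mem_testFunctionals {n : ℕ} {T : (ℕ → ℝ) →ₗ[ℝ] ℝ} (hT : T ∈ testFunctionals n)
    (z : ℕ → ℝ) : T z ^ 2 ≤ ∑ t ∈ Icc 1 n, z t ^ 2 := by
  obtain ⟨a, b, ha, hab, hb, hT⟩ := mem_testFunctionals.1 hT
  have segment_le : ∑ t ∈ Icc a b, z t ^ 2 ≤ ∑ t ∈ Icc 1 n, z t ^ 2 :=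
    sum_le_sum_of_subset_of_nonneg (Icc_subset_Icc ha hb) fun _ _ _ => sq_nonneg _
  refine le_trans ?_ segment_le
  obtain rfl | ⟨l, hl, i, hi, rfl⟩ := hT
  · exact segSum_sq_le a b z
  · exact segCoef_sq_le hab hl hi z

theorem card_testFunctionals_le (n : ℕ) : #(testFunctionals n) ≤ 2 * n ^ 3 := by
  classical
  have card_segments : #{q ∈ Icc 1 n ×ˢ Icc 1 n | q.1 ≤ q.2} ≤ n * n := by
    refine (card_filter_le _ _).trans_eq ?_
    rw [card_product, Nat.card_Icc, Nat.add_sub_cancel]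
  refine (card_biUnion_le_card_mul _ _ (2 * n) fun q hq => ?_).trans ?_
  · obtain ⟨hq, hab⟩ := mem_filter.1 hq
    have := two_pow_padExp_le hab
    have := mem_Icc.1 (mem_product.1 hq).1
    have := mem_Icc.1 (mem_product.1 hq).2
    have card_coefs : #((range (padExp q.1 q.2)).biUnion fun l =>
        (range (2 ^ l)).image fun i => segCoef q.1 q.2 l i) < 2 ^ padExp q.1 q.2 :=
      calc _ ≤ ∑ l ∈ range (padExp q.1 q.2), #((range (2 ^ l)).image fun i =>
              segCoef q.1 q.2 l i) := card_biUnion_le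
        _ ≤ ∑ l ∈ range (padExp q.1 q.2), 2 ^ l :=
            sum_le_sum fun l _ => card_image_le.trans_eq (card_range _)
        _ < 2 ^ padExp q.1 q.2 := Nat.geomSum_lt le_rfl fun l hl => mem_range.1 hl
    exact (card_insert_le _ _).trans (by omega)
  · calc _ ≤ n * n * (2 * n) := Nat.mul_le_mul_right _ card_segments
      _ = 2 * n ^ 3 := by ring

theorem arrowsBeta_mul_log {n : ℕ} (hn : 2 ≤ n) (δ : ℝ) :
    arrowsBeta n δ * Real.log n = 24 * Real.log n + 8 * Real.log (8 / δ) := by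
  have : 0 < Real.log n := Real.log_pos (by exact_mod_cast hn)
  rw [arrowsBeta]
  field_simp

theorem one_le_arrowsBeta_mul_log {n : ℕ} (hn : 2 ≤ n) {δ : ℝ} (hδ : 0 < δ) (hδ1 : δ ≤ 1) :
    1 ≤ arrowsBeta n δ * Real.log n := by
  have log_two_le : Real.log 2 ≤ Real.log n :=
    Real.log_le_log (by norm_num) (by exact_mod_cast hn)
  have log_nonneg : 0 ≤ Real.log (8 / δ) :=
    Real.log_nonneg (by rw [one_le_div hδ]; linarith)
  rw [arrowsBeta_mul_log hn]
  linarith [Real.log_two_gt_d9]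

theorem exp_neg_arrowsBeta_mul_log_half {n : ℕ} (hn : 2 ≤ n) {δ : ℝ} (hδ : 0 < δ) :
    Real.exp (-(arrowsBeta n δ * Real.log n) / 2) = (δ / 8) ^ 4 / n ^ 12 := by
  have : 0 < n := by omega
  have exponent : -(arrowsBeta n δ * Real.log n) / 2 =
      (4 : ℕ) * Real.log (δ / 8) - (12 : ℕ) * Real.log n := by
    rw [arrowsBeta_mul_log hn, ← inv_div δ 8, Real.log_inv]
    push_cast
    ring
  rw [exponent, Real.exp_sub, Real.exp_nat_mul, Real.exp_nat_mul, Real.exp_log (by positivity),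
    Real.exp_log (by positivity)]

open MeasureTheory ProbabilityTheory in
theorem one_sub_le_measureReal_isGoodNoise {Ω : Type*} [MeasurableSpace Ω] {μ : Measure Ω}
    [IsProbabilityMeasure μ] {n : ℕ} {σ : NNReal} {δ : ℝ} {Z : ℕ → Ω → ℝ} (hn : 2 ≤ n)
    (hδ : 0 < δ) (hδ1 : δ ≤ 1) (hindep : iIndepFun (fun t : Finset.Icc 1 n => Z t) μ)
    (hZ : ∀ t ∈ Finset.Icc 1 n, HasSubgaussianMGF (Z t) (σ ^ 2) μ) :
    1 - δ ≤ μ.real {ω | IsGoodNoise n (threshold n σ (arrowsBeta n δ)) (fun t => Z t ω)} := by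
  set ρ := arrowsBeta n δ * Real.log n
  have ρ_nonneg : 0 ≤ ρ := zero_le_one.trans (one_le_arrowsBeta_mul_log hn hδ hδ1)
  have card_le : (#(testFunctionals n) : ℝ) ≤ 2 * n ^ 3 := by
    exact_mod_cast card_testFunctionals_le n
  have pow_le : (n : ℝ) ^ 3 ≤ n ^ 12 :=
    pow_le_pow_right₀ (by exact_mod_cast (by omega : 1 ≤ n)) (by norm_num)
  have δ_pow_le : δ ^ 4 ≤ δ := pow_le_of_le_one hδ.le hδ1 (by norm_num)
  have failure_le : #(testFunctionals n) * (2 * Real.exp (-√ρ ^ 2 / 2)) ≤ δ :=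
    calc _ ≤ 2 * (n : ℝ) ^ 3 * (2 * ((δ / 8) ^ 4 / n ^ 12)) := by
          rw [Real.sq_sqrt ρ_nonneg, exp_neg_arrowsBeta_mul_log_half hn hδ]
          gcongr
      _ = 4 * (δ / 8) ^ 4 * (n ^ 3 / n ^ 12) := by ring
      _ ≤ 4 * (δ / 8) ^ 4 * 1 := by
          gcongr
          exact div_le_one_of_le₀ pow_le (by positivity)
      _ ≤ δ := by linarith
  exact (sub_le_sub_left failure_le 1).trans (one_sub_le_measureReal_forall_abs_le hindep hZ
    (fun T hT => sq_le_of_mem_testFunctionals hT) (Real.sqrt_nonneg ρ))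

section GoodNoise

variable {n a b : ℕ} {lam : ℝ} {z : ℕ → ℝ}

theorem IsGoodNoise.abs_segCoef_le (hz : IsGoodNoise n lam z) (ha : 1 ≤ a) (hab : a ≤ b)
    (hb : b ≤ n) : ∀ l < padExp a b, ∀ i < 2 ^ l, |segCoef a b l i z| ≤ lam :=
  fun l hl i hi => hz _ (mem_testFunctionals.2 ⟨a, b, ha, hab, hb, Or.inr ⟨l, hl, i, hi, rfl⟩⟩)

theorem IsGoodNoise.sq_avg_le (hz : IsGoodNoise n lam z) (ha : 1 ≤ a) (hab : a ≤ b) (hb : b ≤ n) :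
    avg z a b ^ 2 ≤ lam ^ 2 / (b + 1 - a : ℕ) := by
  have segSum_le : |segSum a b z| ≤ lam :=
    hz _ (mem_testFunctionals.2 ⟨a, b, ha, hab, hb, Or.inl rfl⟩)
  have avg_eq : avg z a b = segSum a b z / √(b + 1 - a : ℕ) := by
    rw [segSum_apply, div_div, Real.mul_self_sqrt (Nat.cast_nonneg _), avg]
  rw [avg_eq, div_pow, Real.sq_sqrt (Nat.cast_nonneg _), ← sq_abs]
  gcongr

end GoodNoise

/-! ### The bins -/

section Bins

variable {n : ℕ} {σ β : ℝ} {y : ℕ → ℝ} {t : ℕ}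

theorem binStart_succ_of_restart (ht : 1 ≤ t) (hr : Restart n σ β y (binStart n σ β y t) t) :
    binStart n σ β y (t + 1) = t + 1 := by
  obtain ⟨s, rfl⟩ := Nat.exists_eq_add_of_le' ht
  rw [binStart, if_pos hr]

theorem binStart_succ_of_not_restart (ht : 1 ≤ t)
    (hr : ¬Restart n σ β y (binStart n σ β y t) t) :
    binStart n σ β y (t + 1) = binStart n σ β y t := by
  obtain ⟨s, rfl⟩ := Nat.exists_eq_add_of_le' ht
  rw [binStart, if_neg hr]

theorem binStart_mem_Icc (ht : 1 ≤ t) : binStart n σ β y t ∈ Icc 1 t := by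
  induction t, ht using Nat.le_induction with
  | base => simp [binStart]
  | succ t ht ih =>
    by_cases hr : Restart n σ β y (binStart n σ β y t) t
    · rw [binStart_succ_of_restart ht hr]
      exact right_mem_Icc.2 (Nat.le_add_left 1 t)
    · rw [binStart_succ_of_not_restart ht hr]
      exact Icc_subset_Icc_right t.le_succ ih

theorem binStart_binStart (ht : 1 ≤ t) :
    binStart n σ β y (binStart n σ β y t) = binStart n σ β y t := by
  induction t, ht using Nat.le_induction with
  | base => simp [binStart]
  | succ t ht ih =>
    by_cases hr : Restart n σ β y (binStart n σ β y t) t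
    · rw [binStart_succ_of_restart ht hr, binStart_succ_of_restart ht hr]
    · rw [binStart_succ_of_not_restart ht hr, ih]

theorem binStart_mono {s : ℕ} (hs : 1 ≤ s) (hst : s ≤ t) :
    binStart n σ β y s ≤ binStart n σ β y t := by
  induction t, hst using Nat.le_induction with
  | base => exact le_rfl
  | succ t hst ih =>
    have ht := hs.trans hst
    by_cases hr : Restart n σ β y (binStart n σ β y t) t
    · rw [binStart_succ_of_restart ht hr]
      exact (ih.trans (mem_Icc.1 (binStart_mem_Icc ht)).2).trans t.le_succ
    · rwa [binStart_succ_of_not_restart ht hr]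

theorem binStart_eq_of_mem_Icc {s : ℕ} (ht : 1 ≤ t) (hs : s ∈ Icc (binStart n σ β y t) t) :
    binStart n σ β y s = binStart n σ β y t := by
  obtain ⟨start_le, hst⟩ := mem_Icc.1 hs
  have one_le_start := (mem_Icc.1 (binStart_mem_Icc (n := n) (σ := σ) (β := β) (y := y) ht)).1
  exact le_antisymm (binStart_mono (one_le_start.trans start_le) hst)
    ((binStart_binStart ht).symm.trans_le (binStart_mono one_le_start start_le))

/-- The rounds `h, …, e` form one of the bins of ARROWS on the observations `y 1, …, y n`. The last
bin need not end with a restart. -/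
structure IsBin (n : ℕ) (σ β : ℝ) (y : ℕ → ℝ) (h e : ℕ) : Prop where
  one_le : 1 ≤ h
  start_le_end : h ≤ e
  end_le : e ≤ n
  binStart_eq_iff : ∀ t ∈ Icc 1 n, binStart n σ β y t = h ↔ t ∈ Icc h e
  not_restart : ∀ t ∈ Ico h e, ¬Restart n σ β y h t
  restart_or_eq_last : Restart n σ β y h e ∨ h = binStart n σ β y n

/-- The start times of the bins. -/
noncomputable def binStarts (n : ℕ) (σ β : ℝ) (y : ℕ → ℝ) : Finset ℕ :=
  (Icc 1 n).image (binStart n σ β y)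

theorem exists_isBin {h : ℕ} (hh : h ∈ binStarts n σ β y) : ∃ e, IsBin n σ β y h e := by
  set rounds := {t ∈ Icc 1 n | binStart n σ β y t = h}
  have rounds_nonempty : rounds.Nonempty := by
    obtain ⟨s, hs, hsh⟩ := mem_image.1 hh
    exact ⟨s, mem_filter.2 ⟨hs, hsh⟩⟩
  obtain ⟨e, e_mem, e_max⟩ := rounds.exists_max_image id rounds_nonempty
  obtain ⟨e_mem_Icc, rfl⟩ := mem_filter.1 e_mem
  obtain ⟨one_le_e, e_le⟩ := mem_Icc.1 e_mem_Icc
  obtain ⟨one_le, start_le⟩ := mem_Icc.1 (binStart_mem_Icc (n := n) (σ := σ) (β := β) (y := y)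
    one_le_e)
  refine ⟨e, one_le, start_le, e_le, fun t ht => ⟨fun hte => ?_, binStart_eq_of_mem_Icc one_le_e⟩,
    fun t ht hr => ?_, ?_⟩
  · rw [← hte]
    exact mem_Icc.2 ⟨(mem_Icc.1 (binStart_mem_Icc (mem_Icc.1 ht).1)).2,
      e_max t (mem_filter.2 ⟨ht, hte⟩)⟩
  · obtain ⟨start_le_t, hte⟩ := mem_Ico.1 ht
    have same_bin : ∀ s, t ≤ s → s ≤ e → binStart n σ β y s = binStart n σ β y e := fun s hts hse =>
      binStart_eq_of_mem_Icc one_le_e (mem_Icc.2 ⟨start_le_t.trans hts, hse⟩)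
    rw [← same_bin t le_rfl hte.le] at hr
    have new_bin := binStart_succ_of_restart (one_le.trans start_le_t) hr
    rw [same_bin (t + 1) t.le_succ hte] at new_bin
    omega
  · rcases e_le.eq_or_lt with rfl | e_lt_n
    · exact Or.inr rfl
    · refine Or.inl (by_contra fun hr => e.lt_succ_self.not_ge (e_max (e + 1) ?_))
      exact mem_filter.2 ⟨mem_Icc.2 ⟨by omega, e_lt_n⟩, binStart_succ_of_not_restart one_le_e hr⟩

theorem sum_binStarts_sum_Icc {e : ℕ → ℕ} (he : ∀ h ∈ binStarts n σ β y, IsBin n σ β y h (e h))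
    (g : ℕ → ℝ) : ∑ h ∈ binStarts n σ β y, ∑ t ∈ Icc h (e h), g t = ∑ t ∈ Icc 1 n, g t := by
  refine Eq.trans (sum_congr rfl fun h hh => sum_congr ?_ fun _ _ => rfl)
    (sum_fiberwise_of_maps_to (fun t ht => mem_image_of_mem (binStart n σ β y) ht) g)
  ext t
  have hbin := he h hh
  refine ⟨fun ht => ?_, fun ht => ?_⟩
  · have ht' := Icc_subset_Icc hbin.one_le hbin.end_le ht
    exact mem_filter.2 ⟨ht', (hbin.binStart_eq_iff t ht').2 ht⟩
  · obtain ⟨ht', htb⟩ := mem_filter.1 ht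
    exact (hbin.binStart_eq_iff t ht').1 htb

end Bins

/-! ### The error within a bin -/

/-- The jump of `θ` into time `t`, where `θ 1` counts as no jump. -/
def jump (θ : ℕ → ℝ) (t : ℕ) : ℝ := if 2 ≤ t then |θ t - θ (t - 1)| else 0

/-- The variation of `θ` charged to the bin `h, …, e`. It includes the jump into the bin, so that
the charges of all bins add up to the variation of `θ` on `1, …, n`. -/
def binVariation (θ : ℕ → ℝ) (h e : ℕ) : ℝ := ∑ t ∈ Icc h e, jump θ t

/-- The rate `tvRate` of the bin `h, …, e`, times a bound for twice the number of Haar levels. -/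
noncomputable def binRate (n : ℕ) (θ : ℕ → ℝ) (h e : ℕ) : ℝ :=
  2 * padExp 1 n * tvRate (e + 1 - h : ℕ) (binVariation θ h e)

/-- The factor, logarithmic in `n` and `1 / δ` for `β = arrowsBeta n δ`, by which the squared error
within a bin may exceed `σ²`. -/
noncomputable def logFactor (n : ℕ) (β : ℝ) : ℝ :=
  (4 + 2 * Real.log n) * (β * Real.log n) + 16

theorem jump_nonneg (θ : ℕ → ℝ) (t : ℕ) : 0 ≤ jump θ t := by
  unfold jump
  split_ifs
  exacts [abs_nonneg _, le_rfl]

theorem binVariation_nonneg (θ : ℕ → ℝ) (h e : ℕ) : 0 ≤ binVariation θ h e :=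
  sum_nonneg fun t _ => jump_nonneg θ t

theorem jump_le_binVariation (θ : ℕ → ℝ) {h e t : ℕ} (ht : t ∈ Icc h e) :
    jump θ t ≤ binVariation θ h e :=
  single_le_sum (f := jump θ) (fun t _ => jump_nonneg θ t) ht

theorem variation_eq_sum_jump (θ : ℕ → ℝ) {h : ℕ} (hh : 1 ≤ h) (e : ℕ) :
    variation θ h e = ∑ t ∈ Ioc h e, jump θ t := by
  have shift : variation θ h e = ∑ t ∈ Ico (h + 1) (e + 1), jump θ t := by
    rw [variation, ← sum_Ico_add' (jump θ) h e 1]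
    refine sum_congr rfl fun u hu => ?_
    rw [jump, if_pos (by have := (mem_Ico.1 hu).1; omega), Nat.add_sub_cancel]
  rw [shift]
  exact sum_congr (by ext; simp only [mem_Ico, mem_Ioc]; omega) fun _ _ => rfl

theorem variation_le_binVariation (θ : ℕ → ℝ) {h b e : ℕ} (hh : 1 ≤ h) (hbe : b ≤ e) :
    variation θ h b ≤ binVariation θ h e := by
  rw [variation_eq_sum_jump θ hh, binVariation]
  exact sum_le_sum_of_subset_of_nonneg (Ioc_subset_Icc_self.trans (Icc_subset_Icc_right hbe))
    fun t _ _ => jump_nonneg θ t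

theorem binVariation_one (θ : ℕ → ℝ) {n : ℕ} (hn : 1 ≤ n) :
    binVariation θ 1 n = variation θ 1 n := by
  rw [variation_eq_sum_jump θ le_rfl, binVariation, ← add_sum_Ioc_eq_sum_Icc hn]
  simp [jump]

theorem binRate_nonneg (n : ℕ) (θ : ℕ → ℝ) (h e : ℕ) : 0 ≤ binRate n θ h e :=
  mul_nonneg (by positivity) (tvRate_nonneg (Nat.cast_nonneg _) (binVariation_nonneg θ h e))

theorem padExp_mul_tvRate_le_binRate (θ : ℕ → ℝ) {n h b e : ℕ} (hh : 1 ≤ h) (hhb : h ≤ b)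
    (hbe : b ≤ e) (hen : e ≤ n) :
    padExp h b * tvRate (2 ^ padExp h b) (variation θ h b) ≤ binRate n θ h e := by
  have padExp_le : padExp h b ≤ padExp 1 n := Nat.clog_mono_right 2 (by omega)
  have two_pow_le : (2 : ℝ) ^ padExp h b ≤ 2 * (e + 1 - h : ℕ) := by
    exact_mod_cast (two_pow_padExp_le hhb).trans (by omega)
  have rate_le : tvRate (2 ^ padExp h b) (variation θ h b) ≤
      2 * tvRate (e + 1 - h : ℕ) (binVariation θ h e) :=
    (tvRate_mono (by positivity) two_pow_le (variation_nonneg θ h b)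
      (variation_le_binVariation θ hh hbe)).trans
      (tvRate_two_mul_le (Nat.cast_nonneg _) (binVariation_nonneg θ h e))
  calc _ ≤ (padExp 1 n : ℝ) * (2 * tvRate (e + 1 - h : ℕ) (binVariation θ h e)) :=
        mul_le_mul (by exact_mod_cast padExp_le) rate_le
          (tvRate_nonneg (by positivity) (variation_nonneg θ h b)) (Nat.cast_nonneg _)
    _ = binRate n θ h e := by rw [binRate]; ring

theorem sum_Ioc_one_div_sub (h e : ℕ) :
    ∑ t ∈ Ioc h e, (1 : ℝ) / (t - h : ℕ) = (harmonic (e - h) : ℝ) := by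
  have Ioc_eq : Ioc h e = Ico (h + 1) (e + 1) := by ext; simp only [mem_Ioc, mem_Ico]; omega
  rw [Ioc_eq, sum_Ico_eq_sum_range, Nat.add_sub_add_right, harmonic, Rat.cast_sum]
  refine sum_congr rfl fun i _ => ?_
  have shift : h + 1 + i - h = i + 1 := by omega
  rw [shift]
  push_cast
  rw [one_div]

theorem sum_Ioc_one_div_sub_le {h e n : ℕ} (hen : e ≤ n) :
    ∑ t ∈ Ioc h e, (1 : ℝ) / (t - h : ℕ) ≤ 1 + Real.log n := by
  rw [sum_Ioc_one_div_sub]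
  rcases (e - h).eq_zero_or_pos with h0 | hpos
  · rw [h0, harmonic_zero, Rat.cast_zero]
    have := Real.log_natCast_nonneg n
    positivity
  · refine (harmonic_le_one_add_log _).trans (add_le_add_right (Real.log_le_log ?_ ?_) 1)
    · exact_mod_cast hpos
    · exact_mod_cast (Nat.sub_le e h).trans hen

section IsBin

variable {n : ℕ} {σ β U lam : ℝ} {θ z : ℕ → ℝ} {h e : ℕ}

theorem IsBin.sq_predict_start_sub_le (hbin : IsBin n σ β (θ + z) h e)
    (hz : IsGoodNoise n lam z) (hU : |θ 1| ≤ U) :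
    (predict n σ β (θ + z) h - θ h) ^ 2 ≤
      (if h = 1 then U ^ 2 else 0) + 2 * lam ^ 2 + 2 * binVariation θ h e ^ 2 := by
  obtain ⟨one_le, start_le_end, end_le, binStart_eq_iff, -, -⟩ := hbin
  have binStart_self : binStart n σ β (θ + z) h = h :=
    (binStart_eq_iff h (mem_Icc.2 ⟨one_le, start_le_end.trans end_le⟩)).2
      (left_mem_Icc.2 start_le_end)
  rw [predict, if_pos binStart_self]
  rcases one_le.eq_or_lt with rfl | one_lt
  · rw [if_pos rfl, if_pos rfl, zero_sub, neg_sq, ← sq_abs]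
    have := pow_le_pow_left₀ (abs_nonneg _) hU 2
    nlinarith [sq_nonneg lam, sq_nonneg (binVariation θ 1 e)]
  · rw [if_neg one_lt.ne', if_neg one_lt.ne', zero_add, Pi.add_apply]
    have noise_le : z (h - 1) ^ 2 ≤ lam ^ 2 := by
      simpa [avg] using hz.sq_avg_le (a := h - 1) (by omega) le_rfl (by omega)
    have jump_le := pow_le_pow_left₀ (jump_nonneg θ h)
      (jump_le_binVariation θ (left_mem_Icc.2 start_le_end)) 2
    rw [jump, if_pos (Nat.succ_le_of_lt one_lt), sq_abs] at jump_le
    nlinarith [sq_nonneg (z (h - 1) + (θ h - θ (h - 1)))]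

theorem IsBin.sum_sq_sub_avg_le (hbin : IsBin n σ β (θ + z) h e) (hσ : 0 ≤ σ)
    (hz : IsGoodNoise n (threshold n σ β) z) :
    ∑ t ∈ Ioc h e, (θ t - avg θ h (t - 1)) ^ 2 ≤ 8 * σ ^ 2 +
      2 * (4 * threshold n σ β) ^ (4 / 3 : ℝ) * binRate n θ h e + binVariation θ h e ^ 2 := by
  have threshold_nonneg : 0 ≤ threshold n σ β := mul_nonneg hσ (Real.sqrt_nonneg _)
  have rate_nonneg := binRate_nonneg n θ h e
  rcases hbin.start_le_end.eq_or_lt with rfl | start_lt_end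
  · rw [Ioc_self, sum_empty]
    positivity
  obtain ⟨b, rfl⟩ : ∃ b, e = b + 1 := ⟨e - 1, by omega⟩
  have start_le_b : h ≤ b := Nat.le_of_lt_succ start_lt_end
  have b_le : b ≤ n := b.le_succ.trans hbin.end_le
  rw [sum_Ioc_succ_top start_le_b, Nat.add_sub_cancel]
  have stat_le : restartStat (threshold n σ β) (θ + z) h b ≤ σ := not_lt.1 fun hlt =>
    hbin.not_restart b (mem_Ico.2 ⟨start_le_b, b.lt_succ_self⟩) ((restart_iff n σ β _ h b).2 hlt)
  have stat_sq_le := pow_le_pow_left₀ (restartStat_nonneg _ (θ + z) h b) stat_le 2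
  have before_last := sum_sq_sub_avg_le_restartStat start_le_b threshold_nonneg
    (θ := θ) (hz.abs_segCoef_le hbin.one_le start_le_b b_le)
  have rate_le := mul_le_mul_of_nonneg_left
    (padExp_mul_tvRate_le_binRate θ hbin.one_le start_le_b b.le_succ hbin.end_le)
    (by positivity : 0 ≤ (4 * threshold n σ β) ^ (4 / 3 : ℝ))
  have last_le : |θ (b + 1) - avg θ h b| ≤ binVariation θ h (b + 1) :=
    abs_sub_avg_le θ start_le_b fun s hs =>
      (abs_sub_le_variation θ (right_mem_Icc.2 hbin.start_le_end)
        (Icc_subset_Icc_right b.le_succ hs)).trans (variation_le_binVariation θ hbin.one_le le_rfl)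
  have last_sq_le := pow_le_pow_left₀ (abs_nonneg _) last_le 2
  rw [sq_abs] at last_sq_le
  linarith [sum_sq_sub_running_avg_le θ start_le_b]

theorem IsBin.sq_predict_sub_le (hbin : IsBin n σ β (θ + z) h e) (hz : IsGoodNoise n lam z)
    {t : ℕ} (ht : t ∈ Ioc h e) :
    (predict n σ β (θ + z) t - θ t) ^ 2 ≤
      2 * lam ^ 2 * (1 / (t - h : ℕ)) + 2 * (θ t - avg θ h (t - 1)) ^ 2 := by
  obtain ⟨start_lt, le_end⟩ := mem_Ioc.1 ht
  have one_le := hbin.one_le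
  have end_le := hbin.end_le
  have binStart_eq : binStart n σ β (θ + z) t = h :=
    (hbin.binStart_eq_iff t (mem_Icc.2 ⟨by omega, by omega⟩)).2 (Ioc_subset_Icc_self ht)
  have noise_le := hz.sq_avg_le one_le (Nat.le_sub_one_of_lt start_lt) (by omega)
  rw [Nat.sub_add_cancel (by omega), ← mul_one_div] at noise_le
  rw [predict, binStart_eq, if_neg start_lt.ne, avg_add]
  nlinarith [sq_nonneg (avg z h (t - 1) + (θ t - avg θ h (t - 1)))]

theorem four_mul_threshold_rpow_le (hσ : 0 ≤ σ) (hβ : 1 ≤ β * Real.log n) :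
    (4 * threshold n σ β) ^ (4 / 3 : ℝ) ≤ 16 * (β * Real.log n) * σ ^ (4 / 3 : ℝ) := by
  set ρ := β * Real.log n
  have sqrt_eq : 4 * (σ * √ρ) = √(16 * ρ) * σ := by
    rw [show 16 * ρ = 4 ^ 2 * ρ by norm_num, Real.sqrt_mul (sq_nonneg 4),
      Real.sqrt_sq zero_le_four]
    ring
  rw [threshold, sqrt_eq, Real.mul_rpow (Real.sqrt_nonneg _) hσ]
  refine mul_le_mul_of_nonneg_right ?_ (by positivity)
  rw [Real.sqrt_eq_rpow, ← Real.rpow_mul (by linarith)]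
  exact Real.rpow_le_self_of_one_le (by linarith) (by norm_num)

theorem IsBin.sum_sq_predict_sub_le (hbin : IsBin n σ β (θ + z) h e) (hσ : 0 ≤ σ)
    (hβ : 1 ≤ β * Real.log n) (hz : IsGoodNoise n (threshold n σ β) z) (hU : |θ 1| ≤ U) :
    ∑ t ∈ Icc h e, (predict n σ β (θ + z) t - θ t) ^ 2 ≤
      (if h = 1 then U ^ 2 else 0) + 4 * binVariation θ h e ^ 2 + logFactor n β * σ ^ 2 +
        64 * (β * Real.log n) * σ ^ (4 / 3 : ℝ) * binRate n θ h e := by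
  have start_le := hbin.sq_predict_start_sub_le hz hU
  have later_le := sum_le_sum fun t ht => hbin.sq_predict_sub_le hz (t := t) ht
  rw [sum_add_distrib, ← mul_sum, ← mul_sum] at later_le
  have harmonic_le := mul_le_mul_of_nonneg_left (sum_Ioc_one_div_sub_le (h := h) hbin.end_le)
    (by positivity : 0 ≤ 2 * threshold n σ β ^ 2)
  have bias_le := hbin.sum_sq_sub_avg_le hσ hz
  have rate_le := mul_le_mul_of_nonneg_right (four_mul_threshold_rpow_le hσ hβ)
    (binRate_nonneg n θ h e)
  have threshold_sq : threshold n σ β ^ 2 = β * Real.log n * σ ^ 2 := by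
    rw [threshold, mul_pow, Real.sq_sqrt (by linarith), mul_comm]
  rw [threshold_sq] at start_le later_le harmonic_le
  rw [← add_sum_Ioc_eq_sum_Icc hbin.start_le_end, logFactor]
  linarith

theorem IsBin.sq_le (hbin : IsBin n σ β (θ + z) h e) (hσ : 0 ≤ σ)
    (hz : IsGoodNoise n (threshold n σ β) z) :
    σ ^ 2 ≤ (if h = binStart n σ β (θ + z) n then σ ^ 2 else 0) +
      σ ^ (4 / 3 : ℝ) * binRate n θ h e := by
  have rate_nonneg := binRate_nonneg n θ h e
  rcases hbin.restart_or_eq_last with restart | eq_last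
  · calc σ ^ 2 ≤ σ ^ (4 / 3 : ℝ) * (padExp h e * tvRate (2 ^ padExp h e) (variation θ h e)) :=
          sq_le_of_restart hσ hbin.start_le_end
            (hz.abs_segCoef_le hbin.one_le hbin.start_le_end hbin.end_le) restart
      _ ≤ σ ^ (4 / 3 : ℝ) * binRate n θ h e :=
          mul_le_mul_of_nonneg_left (padExp_mul_tvRate_le_binRate θ hbin.one_le
            hbin.start_le_end le_rfl hbin.end_le) (by positivity)
      _ ≤ _ := le_add_of_nonneg_left (by split_ifs <;> positivity)
  · rw [if_pos eq_last]
    exact le_add_of_nonneg_right (by positivity)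

end IsBin

/-! ### The regret bound -/

section Total

variable {n : ℕ} {σ β U : ℝ} {θ z y : ℕ → ℝ} {e : ℕ → ℕ}

theorem sum_binVariation (hn : 1 ≤ n) (he : ∀ h ∈ binStarts n σ β y, IsBin n σ β y h (e h)) :
    ∑ h ∈ binStarts n σ β y, binVariation θ h (e h) = variation θ 1 n := by
  rw [← binVariation_one θ hn]
  exact sum_binStarts_sum_Icc he (jump θ)

theorem sum_binLength (he : ∀ h ∈ binStarts n σ β y, IsBin n σ β y h (e h)) :
    ∑ h ∈ binStarts n σ β y, ((e h + 1 - h : ℕ) : ℝ) = n := by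
  simpa using sum_binStarts_sum_Icc he fun _ => 1

theorem sum_binRate_le (hn : 1 ≤ n) (he : ∀ h ∈ binStarts n σ β y, IsBin n σ β y h (e h)) :
    ∑ h ∈ binStarts n σ β y, binRate n θ h (e h) ≤
      2 * padExp 1 n * tvRate n (variation θ 1 n) := by
  unfold binRate
  rw [← mul_sum, ← sum_binVariation hn he, ← sum_binLength he]
  exact mul_le_mul_of_nonneg_left (sum_tvRate_le _ (fun _ _ => Nat.cast_nonneg _)
    fun h _ => binVariation_nonneg θ h (e h)) (by positivity)

theorem sum_ite_eq_le (s : Finset ℕ) (a : ℕ) {x : ℝ} (hx : 0 ≤ x) :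
    ∑ h ∈ s, (if h = a then x else 0) ≤ x := by
  rw [sum_ite_eq']
  split_ifs
  exacts [le_rfl, hx]

theorem sum_sq_predict_sub_le (hn : 1 ≤ n) (hσ : 0 ≤ σ) (hβ : 1 ≤ β * Real.log n)
    (hz : IsGoodNoise n (threshold n σ β) z) (hU : |θ 1| ≤ U) :
    ∑ t ∈ Icc 1 n, (predict n σ β (θ + z) t - θ t) ^ 2 ≤
      U ^ 2 + 4 * variation θ 1 n ^ 2 + logFactor n β * σ ^ 2 +
        34 * logFactor n β * padExp 1 n * σ ^ (4 / 3 : ℝ) * tvRate n (variation θ 1 n) := by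
  set S := binStarts n σ β (θ + z)
  choose! e he using fun h (hh : h ∈ S) => exists_isBin hh
  have log_nonneg := Real.log_natCast_nonneg n
  have rho_le : 4 * (β * Real.log n) ≤ logFactor n β := by
    rw [logFactor]
    nlinarith
  have factor_nonneg : 0 ≤ logFactor n β := by linarith
  have bin_le : ∀ h ∈ S, ∑ t ∈ Icc h (e h), (predict n σ β (θ + z) t - θ t) ^ 2 ≤
      (if h = 1 then U ^ 2 else 0) + 4 * binVariation θ h (e h) ^ 2 +
        logFactor n β * (if h = binStart n σ β (θ + z) n then σ ^ 2 else 0) +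
        17 * logFactor n β * σ ^ (4 / 3 : ℝ) * binRate n θ h (e h) := fun h hh => by
    have rate_nonneg : 0 ≤ σ ^ (4 / 3 : ℝ) * binRate n θ h (e h) :=
      mul_nonneg (by positivity) (binRate_nonneg n θ h (e h))
    linarith [(he h hh).sum_sq_predict_sub_le hσ hβ hz hU,
      mul_le_mul_of_nonneg_left ((he h hh).sq_le hσ hz) factor_nonneg,
      mul_le_mul_of_nonneg_right rho_le rate_nonneg]
  have variation_sq_le : ∑ h ∈ S, binVariation θ h (e h) ^ 2 ≤ variation θ 1 n ^ 2 :=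
    (sum_sq_le_sq_sum_of_nonneg fun h _ => binVariation_nonneg θ h (e h)).trans_eq
      (congrArg (· ^ 2) (sum_binVariation hn he))
  calc _ = ∑ h ∈ S, ∑ t ∈ Icc h (e h), (predict n σ β (θ + z) t - θ t) ^ 2 :=
        (sum_binStarts_sum_Icc he _).symm
    _ ≤ _ := sum_le_sum bin_le
    _ ≤ U ^ 2 + 4 * variation θ 1 n ^ 2 + logFactor n β * σ ^ 2 + 17 * logFactor n β *
          σ ^ (4 / 3 : ℝ) * (2 * padExp 1 n * tvRate n (variation θ 1 n)) := by
        simp only [sum_add_distrib, ← mul_sum]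
        gcongr
        · exact sum_ite_eq_le S 1 (sq_nonneg U)
        · exact sum_ite_eq_le S _ (sq_nonneg σ)
        · exact sum_binRate_le hn he
    _ = _ := by ring

end Total

theorem dynamicRegret_quadLoss (n : ℕ) (θ x : ℕ → ℝ) :
    dynamicRegret n (quadLoss θ) x = ∑ t ∈ Icc 1 n, (x t - θ t) ^ 2 := by
  have iInf_eq_zero : ∀ t, ⨅ u : ℝ, quadLoss θ t u = 0 := fun t => by
    refine le_antisymm ?_ (Real.iInf_nonneg fun u => sq_nonneg _)
    refine (ciInf_le ⟨0, ?_⟩ (θ t)).trans (by simp [quadLoss])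
    rintro _ ⟨u, rfl⟩
    exact sq_nonneg _
  simp only [dynamicRegret, iInf_eq_zero, sum_const_zero, sub_zero]
  rfl

theorem padExp_one_le {n : ℕ} (hn : 2 ≤ n) : (padExp 1 n : ℝ) ≤ 1 + 2 * Real.log n := by
  have pow_pred_lt := Nat.pow_pred_clog_lt_self one_lt_two hn
  obtain ⟨k, hk⟩ := Nat.exists_eq_succ_of_ne_zero (Nat.clog_pos one_lt_two hn).ne'
  rw [hk, Nat.pred_succ] at pow_pred_lt
  have log_le : k * Real.log 2 ≤ Real.log n := by
    rw [← Real.log_pow]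
    exact Real.log_le_log (by positivity) (by exact_mod_cast pow_pred_lt.le)
  rw [padExp, Nat.add_sub_cancel, hk, Nat.cast_succ]
  nlinarith [Real.log_two_gt_d9, (Nat.cast_nonneg k : (0 : ℝ) ≤ k)]

section Polylog

variable {n : ℕ} {δ : ℝ}

theorem log_one_div_nonneg (hδ : 0 < δ) (hδ1 : δ ≤ 1) : 0 ≤ Real.log (1 / δ) :=
  Real.log_nonneg (one_le_one_div hδ hδ1)

theorem logFactor_arrowsBeta_le (hn : 2 ≤ n) (hδ : 0 < δ) (hδ1 : δ ≤ 1) :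
    logFactor n (arrowsBeta n δ) ≤ 112 * (1 + Real.log n + Real.log (1 / δ)) ^ 2 := by
  have log_nonneg := Real.log_natCast_nonneg n
  have log_δ_nonneg := log_one_div_nonneg hδ hδ1
  have log_eight_div : Real.log (8 / δ) = 3 * Real.log 2 + Real.log (1 / δ) := by
    rw [show 8 / δ = 2 ^ 3 * (1 / δ) by ring, Real.log_mul (by norm_num) (by positivity),
      Real.log_pow, Nat.cast_ofNat]
  have ρ_le : arrowsBeta n δ * Real.log n ≤ 24 * (1 + Real.log n + Real.log (1 / δ)) := by
    rw [arrowsBeta_mul_log hn, log_eight_div]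
    linarith [Real.log_two_lt_d9]
  rw [logFactor]
  nlinarith [one_le_arrowsBeta_mul_log hn hδ hδ1]

theorem regret_bound_le_polylog (hn : 2 ≤ n) (hδ : 0 < δ) (hδ1 : δ ≤ 1) {σ V C : ℝ} (U : ℝ)
    (hσ : 0 ≤ σ) (hV : 0 ≤ V) (hVC : V ≤ C) :
    U ^ 2 + 4 * V ^ 2 + logFactor n (arrowsBeta n δ) * σ ^ 2 +
        34 * logFactor n (arrowsBeta n δ) * padExp 1 n * σ ^ (4 / 3 : ℝ) * tvRate n V ≤
      7616 * (1 + Real.log n + Real.log (1 / δ)) ^ 3 *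
        ((n : ℝ) ^ (1 / 3 : ℝ) * C ^ (2 / 3 : ℝ) * σ ^ (4 / 3 : ℝ) + U ^ 2 + C ^ 2 + σ ^ 2) := by
  have factor_le := logFactor_arrowsBeta_le hn hδ hδ1
  have log_nonneg := Real.log_natCast_nonneg n
  have log_δ_nonneg := log_one_div_nonneg hδ hδ1
  have padExp_le : (padExp 1 n : ℝ) ≤ 2 * (1 + Real.log n + Real.log (1 / δ)) := by
    linarith [padExp_one_le hn]
  set Λ := 1 + Real.log n + Real.log (1 / δ)
  have one_le_Λ : 1 ≤ Λ := by linarith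
  have one_le_pow : 1 ≤ Λ ^ 3 := one_le_pow₀ one_le_Λ
  have sq_le_pow : Λ ^ 2 ≤ Λ ^ 3 := pow_le_pow_right₀ one_le_Λ (by norm_num)
  have main_le : 34 * logFactor n (arrowsBeta n δ) * padExp 1 n * σ ^ (4 / 3 : ℝ) * tvRate n V ≤
      7616 * Λ ^ 3 * (tvRate n C * σ ^ (4 / 3 : ℝ)) :=
    calc _ ≤ 34 * (112 * Λ ^ 2) * (2 * Λ) * σ ^ (4 / 3 : ℝ) * tvRate n C := by
          have := tvRate_nonneg n.cast_nonneg hV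
          gcongr
          exact tvRate_mono n.cast_nonneg le_rfl hV hVC
      _ = _ := by ring
  have U_le : U ^ 2 ≤ 7616 * Λ ^ 3 * U ^ 2 :=
    le_mul_of_one_le_left (sq_nonneg U) (by linarith)
  have V_le : 4 * V ^ 2 ≤ 7616 * Λ ^ 3 * C ^ 2 :=
    mul_le_mul (by linarith) (pow_le_pow_left₀ hV hVC 2) (sq_nonneg V) (by linarith)
  have σ_le : logFactor n (arrowsBeta n δ) * σ ^ 2 ≤ 7616 * Λ ^ 3 * σ ^ 2 :=
    mul_le_mul_of_nonneg_right (by linarith) (sq_nonneg σ)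
  rw [← tvRate]
  linarith

end Polylog

end Arrows

theorem corollary1 :
    ∃ K : ℝ, 0 < K ∧ ∃ p : ℕ,
      ∀ (Ω : Type*) [MeasurableSpace Ω] (μ : MeasureTheory.Measure Ω)
        [MeasureTheory.IsProbabilityMeasure μ]
        (n : ℕ) (σ : NNReal) (δ C U : ℝ) (θ : ℕ → ℝ) (Z : ℕ → Ω → ℝ),
        2 ≤ n → 0 < δ → δ ≤ 1 →
        ProbabilityTheory.iIndepFun (fun t : Finset.Icc 1 n => Z t) μ →
        (∀ t ∈ Finset.Icc 1 n, ProbabilityTheory.HasSubgaussianMGF (Z t) (σ ^ 2) μ) →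
        θ ∈ Arrows.TVClass n C →
        |θ 1| ≤ U →
        1 - δ ≤ μ.real {ω |
          Arrows.dynamicRegret n (Arrows.quadLoss θ)
            (Arrows.predict n σ (24 + 8 * Real.log (8 / δ) / Real.log n)
              (fun t => θ t + Z t ω)) ≤
          K * (1 + Real.log n + Real.log (1 / δ)) ^ p *
            ((n : ℝ) ^ (1 / 3 : ℝ) * C ^ (2 / 3 : ℝ) * (σ : ℝ) ^ (4 / 3 : ℝ)
              + U ^ 2 + C ^ 2 + (σ : ℝ) ^ 2)} := by
  refine ⟨7616, by norm_num, 3, ?_⟩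
  intro Ω _ μ _ n σ δ C U θ Z hn hδ hδ1 hindep hZ hC hU
  refine (Arrows.one_sub_le_measureReal_isGoodNoise hn hδ hδ1 hindep hZ).trans
    (MeasureTheory.measureReal_mono fun ω good_noise => ?_)
  refine (Arrows.dynamicRegret_quadLoss n θ _).trans_le ?_
  exact (Arrows.sum_sq_predict_sub_le (one_le_two.trans hn) σ.2
      (Arrows.one_le_arrowsBeta_mul_log hn hδ hδ1) good_noise hU).trans
    (Arrows.regret_bound_le_polylog hn hδ hδ1 U σ.2 (Arrows.variation_nonneg θ 1 n) hC)
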